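/- Let $E$ be a real separable infinite-dimensional Hilbert space with an orthonormal basis $\mathcal E=\{e_k\}_{k\ge1}$. For bounded real sequences $a,b$ with $a_j<b_j$ for all $j$, the block $\Pi_{a,b}=\{x\in E:(e_j,x)\in[a_j,b_j)\ \forall j\}$ is called absolutely measurable if it is empty or $\sum_j\max\{0,\ln(b_j-a_j)\}<\infty$; put $\lambda(\Pi_{a,b})=\prod_j(b_j-a_j)$ if $\Pi_{a,b}\ne\emptyset$ and $\lambda(\emptyset)=0$. Let $\lambda$ also denote the finitely additive extension of this set function to the minimal ring $r_{\mathcal E}$ of sets containing all absolutely measurable blocks, and to the completion $\mathcal R_{\mathcal E}$ of that ring, which consists of the sets $A\subseteq E$ such that for every $\varepsilon>0$ there are $B,C\in r_{\mathcal E}$ with $B\subseteq A\subseteq C$ and $\lambda(C\setminus B)<\varepsilon$. Let $\mathcal H_{\mathcal E}$ be the complex Hilbert space obtained by completing the space of linear combinations of indicator functions of sets of $\mathcal R_{\mathcal E}$, modulo functions of norm zero, with respect to the form $(f,g)\mapsto\int \bar f g\,d\lambda$. For $h\in E$ let $S_h$ be the shift operator on $\mathcal H_{\mathcal E}$ given by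 $S_hf(x)=f(x-h)$. For a nonnegative nuclear operator $B$ on $E$ that is diagonal in the basis $\mathcal E$, let $\nu_B$ be the centered Gaussian measure on $E$ with covariance operator $B$, i.e. with characteristic function $\xi\mapsto\exp(-\tfrac12(B\xi,\xi))$, and let $\mathcal U_B=\int_E S_h\,d\nu_B(h)$ (Pettis integral), i.e. $(g,\mathcal U_Bf)=\int_E(g,S_hf)\,d\nu_B(h)$ for all $f,g\in\mathcal H_{\mathcal E}$. **Theorem.** Let $D$ be a nonnegative self-adjoint nuclear operator on $E$ such that every $e_k$ is an eigenvector of $D$, and suppose that $D^{1/2}$ is nuclear as well. Let $P_m$ be the orthogonal projection onto $\mathrm{span}(e_1,\dots,e_m)$ and $D_m=DP_m$. Then the measures $\nu_{tD}$, $\nu_{tD_m}$ and the bounded operators $\mathcal U_{tD}$, $\mathcal U_{tD_m}$ exist for all $t\ge0$ and $m$, and for every $T>0$ and every $f\in\mathcal H_{\mathcal E}$ $$\lim_{m\to\infty}\ \sup_{t\in[0,T]}\ \|\mathcal U_{tD}f-\mathcal U_{tD_m}f\|_{\mathcal H_{\mathcal E}}=0 .$$ Consequently the family $(\mathcal U_{tD})_{t\ge0}$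 is a strongly continuous semigroup: $\mathcal U_{0}=I$, $\mathcal U_{(s+t)D}=\mathcal U_{sD}\,\mathcal U_{tD}$ for $s,t\ge0$, and $t\mapsto\mathcal U_{tD}f$ is continuous on $[0,\infty)$ for every $f\in\mathcal H_{\mathcal E}$. -/

import Mathlib

open MeasureTheory ProbabilityTheory Filter Topology Set
open scoped InnerProductSpace ComplexConjugate NNReal

noncomputable section

namespace ShiftAvg

section Family

variable {α ι : Type*}

/-- The indicator function of a set, with complex values. -/
def ind (A : Set α) : α → ℂ := A.indicator 1

/-- The formal linear combination `∑ cᵢ [Aᵢ]` as the function `∑ cᵢ χ_{Aᵢ}`. -/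
def comb (A : ι → Set α) : (ι →₀ ℂ) →ₗ[ℂ] (α → ℂ) :=
  Finsupp.linearCombination ℂ fun i => ind (A i)

/-- The number `∑ cᵢ wᵢ`. -/
def wsum (w : ι → ℝ) : (ι →₀ ℂ) →ₗ[ℂ] ℂ :=
  Finsupp.linearCombination ℂ fun i => (w i : ℂ)

open Classical in
/-- The integral of a linear combination of indicator functions of the sets `A i`, where `A i` has
the measure `w i`: the integral of `∑ cᵢ χ_{Aᵢ}` is `∑ cᵢ wᵢ`, see `integ_comb`. -/
def integ (A : ι → Set α) (w : ι → ℝ) (f : α → ℂ) : ℂ :=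
  if h : ∃ c, comb A c = f then wsum w h.choose else 0

/-- Nonnegative real linear combinations of the indicator functions have nonnegative sums. -/
def PosWeight (A : ι → Set α) (w : ι → ℝ) : Prop :=
  ∀ (s : Finset ι) (c : ι → ℝ), (∀ x, 0 ≤ ∑ i ∈ s, c i * (A i).indicator 1 x) →
    0 ≤ ∑ i ∈ s, c i * w i

lemma comb_apply (A : ι → Set α) (c : ι →₀ ℂ) (x : α) :
    comb A c x = ∑ i ∈ c.support, c i * ind (A i) x := by
  simp [comb, Finsupp.linearCombination_apply, Finsupp.sum, Finset.sum_apply]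

lemma wsum_apply (w : ι → ℝ) (c : ι →₀ ℂ) : wsum w c = ∑ i ∈ c.support, c i * (w i : ℂ) := by
  simp [wsum, Finsupp.linearCombination_apply, Finsupp.sum]

lemma comb_re (A : ι → Set α) (c : ι →₀ ℂ) (x : α) :
    (comb A c x).re = ∑ i ∈ c.support, (c i).re * (A i).indicator 1 x := by
  rw [comb_apply, Complex.re_sum]
  refine Finset.sum_congr rfl fun i _ => ?_
  by_cases h : x ∈ A i <;> simp [ind, h]

lemma wsum_re (w : ι → ℝ) (c : ι →₀ ℂ) : (wsum w c).re = ∑ i ∈ c.support, (c i).re * w i := by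
  simp [wsum_apply]

lemma PosWeight.re_nonneg {A : ι → Set α} {w : ι → ℝ} (hw : PosWeight A w) (c : ι →₀ ℂ)
    (h : ∀ x, 0 ≤ (comb A c x).re) : 0 ≤ (wsum w c).re := by
  rw [wsum_re]
  exact hw _ _ fun x => by rw [← comb_re]; exact h x

lemma PosWeight.eq_zero {A : ι → Set α} {w : ι → ℝ} (hw : PosWeight A w) (c : ι →₀ ℂ)
    (h : comb A c = 0) : wsum w c = 0 := by
  have key : ∀ z : ℂ, (z * wsum w c).re = 0 := by
    intro z
    have h1 := hw.re_nonneg (z • c) (fun x => by simp [h])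
    have h2 := hw.re_nonneg (-(z • c)) (fun x => by simp [h])
    simp only [map_neg, map_smul, smul_eq_mul, Complex.neg_re] at h1 h2
    linarith
  apply Complex.ext
  · simpa using key 1
  · simpa using key Complex.I

lemma integ_comb {A : ι → Set α} {w : ι → ℝ} (hw : PosWeight A w) (c : ι →₀ ℂ) :
    integ A w (comb A c) = wsum w c := by
  have h : ∃ c', comb A c' = comb A c := ⟨c, rfl⟩
  rw [integ, dif_pos h]
  have := hw.eq_zero (h.choose - c) (by rw [map_sub, h.choose_spec, sub_self])
  rwa [map_sub, sub_eq_zero] at this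

/-- The linear combinations of the indicator functions of the sets `A i`. -/
def simpleSpan (A : ι → Set α) : Submodule ℂ (α → ℂ) :=
  Submodule.span ℂ (range fun i => ind (A i))

lemma mem_simpleSpan {A : ι → Set α} {f : α → ℂ} : f ∈ simpleSpan A ↔ ∃ c, comb A c = f := by
  rw [simpleSpan, Finsupp.mem_span_range_iff_exists_finsupp]
  simp [comb, Finsupp.linearCombination_apply]

lemma ind_mem (A : ι → Set α) (i : ι) : ind (A i) ∈ simpleSpan A :=
  Submodule.subset_span ⟨i, rfl⟩

lemma integ_ind {A : ι → Set α} {w : ι → ℝ} (hw : PosWeight A w) (i : ι) :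
    integ A w (ind (A i)) = w i := by
  have := integ_comb hw (Finsupp.single i 1)
  simpa [comb, wsum] using this

lemma integ_add {A : ι → Set α} {w : ι → ℝ} (hw : PosWeight A w) {f g : α → ℂ}
    (hf : f ∈ simpleSpan A) (hg : g ∈ simpleSpan A) :
    integ A w (f + g) = integ A w f + integ A w g := by
  obtain ⟨c, rfl⟩ := mem_simpleSpan.1 hf
  obtain ⟨d, rfl⟩ := mem_simpleSpan.1 hg
  rw [← map_add, integ_comb hw, integ_comb hw, integ_comb hw, map_add]

lemma integ_smul {A : ι → Set α} {w : ι → ℝ} (hw : PosWeight A w) {f : α → ℂ} (z : ℂ)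
    (hf : f ∈ simpleSpan A) : integ A w (z • f) = z * integ A w f := by
  obtain ⟨c, rfl⟩ := mem_simpleSpan.1 hf
  rw [← map_smul, integ_comb hw, integ_comb hw, map_smul, smul_eq_mul]

lemma integ_re_nonneg {A : ι → Set α} {w : ι → ℝ} (hw : PosWeight A w) {f : α → ℂ}
    (hf : f ∈ simpleSpan A) (h : ∀ x, 0 ≤ (f x).re) : 0 ≤ (integ A w f).re := by
  obtain ⟨c, rfl⟩ := mem_simpleSpan.1 hf
  rw [integ_comb hw]
  exact hw.re_nonneg c h

lemma conj_comb (A : ι → Set α) (c : ι →₀ ℂ) :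
    (fun x => conj (comb A c x)) = comb A (c.mapRange conj (map_zero _)) := by
  funext x
  rw [comb_apply, comb_apply, map_sum,
    Finsupp.support_mapRange_of_injective _ _ (starRingEnd ℂ).injective]
  refine Finset.sum_congr rfl fun i _ => ?_
  by_cases h : x ∈ A i <;> simp [ind, h]

lemma conj_mem {A : ι → Set α} {f : α → ℂ} (hf : f ∈ simpleSpan A) :
    (fun x => conj (f x)) ∈ simpleSpan A := by
  obtain ⟨c, rfl⟩ := mem_simpleSpan.1 hf
  exact mem_simpleSpan.2 ⟨_, (conj_comb A c).symm⟩

lemma integ_conj {A : ι → Set α} {w : ι → ℝ} (hw : PosWeight A w) {f : α → ℂ}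
    (hf : f ∈ simpleSpan A) : integ A w (fun x => conj (f x)) = conj (integ A w f) := by
  obtain ⟨c, rfl⟩ := mem_simpleSpan.1 hf
  rw [conj_comb, integ_comb hw, integ_comb hw, wsum_apply, wsum_apply, map_sum,
    Finsupp.support_mapRange_of_injective _ _ (starRingEnd ℂ).injective]
  exact Finset.sum_congr rfl fun i _ => by simp

lemma mul_mem {A : ι → Set α} (hA : ∀ i j, ∃ k, A k = A i ∩ A j) {f g : α → ℂ}
    (hf : f ∈ simpleSpan A) (hg : g ∈ simpleSpan A) : f * g ∈ simpleSpan A := by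
  have hfg : f * g ∈ simpleSpan A * simpleSpan A := Submodule.mul_mem_mul hf hg
  rw [simpleSpan, Submodule.span_mul_span] at hfg
  refine Submodule.span_mono ?_ hfg
  rintro _ ⟨_, ⟨i, rfl⟩, _, ⟨j, rfl⟩, rfl⟩
  obtain ⟨k, hk⟩ := hA i j
  refine ⟨k, ?_⟩
  funext x
  by_cases h1 : x ∈ A i <;> by_cases h2 : x ∈ A j <;> simp [ind, hk, h1, h2]

/-- A nonnegative finitely additive set function on a ring of sets is a positive weight. -/
lemma posWeight_of_additive {R : Set (Set α)} (hR : IsSetRing R) (m : Set α → ℝ)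
    (h0 : m ∅ = 0) (hm : ∀ A ∈ R, 0 ≤ m A)
    (hadd : ∀ A ∈ R, ∀ B ∈ R, Disjoint A B → m (A ∪ B) = m A + m B) :
    PosWeight (fun A : R => (A : Set α)) (fun A : R => m A) := by
  classical
  have split : ∀ A ∈ R, ∀ B ∈ R, m B = m (B ∩ A) + m (B \ A) := by
    intro A hA B hB
    rw [← hadd _ (hR.inter_mem hB hA) _ (hR.sdiff_mem hB hA) disjoint_sdiff_inter.symm,
      inter_union_sdiff]
  have key : ∀ (c : R → ℝ) (s : Finset R) (d : ℝ), ∀ B ∈ R,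
      (∀ x ∈ B, 0 ≤ d + ∑ i ∈ s, c i * (i : Set α).indicator 1 x) →
      0 ≤ d * m B + ∑ i ∈ s, c i * m (B ∩ i) := by
    intro c s
    induction s using Finset.induction_on with
    | empty =>
      intro d B hB h
      rcases B.eq_empty_or_nonempty with rfl | ⟨x, hx⟩
      · simp [h0]
      · have := h x hx
        simp only [Finset.sum_empty, add_zero] at this ⊢
        exact mul_nonneg this (hm B hB)
    | insert j s hj ih =>
      intro d B hB h
      have h1 := ih (d + c j) (B ∩ j) (hR.inter_mem hB j.2) (by
        rintro x ⟨hx, hxj⟩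
        have := h x hx
        rw [Finset.sum_insert hj] at this
        simp only [hxj, indicator_of_mem, Pi.one_apply, mul_one] at this
        linarith)
      have h2 := ih d (B \ j) (hR.sdiff_mem hB j.2) (by
        rintro x ⟨hx, hxj⟩
        have := h x hx
        rw [Finset.sum_insert hj] at this
        simp only [hxj, not_false_eq_true, indicator_of_notMem, mul_zero] at this
        linarith)
      have h3 : ∑ i ∈ s, c i * m (B ∩ i)
          = ∑ i ∈ s, c i * m (B ∩ j ∩ i) + ∑ i ∈ s, c i * m (B \ j ∩ i) := by
        rw [← Finset.sum_add_distrib]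
        refine Finset.sum_congr rfl fun i _ => ?_
        rw [← mul_add, split j j.2 (B ∩ i) (hR.inter_mem hB i.2), inter_right_comm,
          sdiff_inter_right_comm]
      rw [Finset.sum_insert hj, h3, split j j.2 B hB]
      linarith
  intro s c h
  have hU : (⋃ i ∈ s, (i : Set α)) ∈ R := hR.biUnion_mem s fun i _ => i.2
  have := key c s 0 _ hU (fun x _ => by simpa using h x)
  simp only [zero_mul, zero_add] at this
  convert this using 2 with i hi
  have hi' : (⋃ i ∈ s, (i : Set α)) ∩ (i : Set α) = i :=
    inter_eq_right.2 (subset_iUnion₂ (s := fun (i : R) (_ : i ∈ s) => (i : Set α)) i hi)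
  rw [hi']

end Family

section Content

variable {E : Type*} [NormedAddCommGroup E] [InnerProductSpace ℝ E]

/-- The block `{x | (e_j, x) ∈ [a_j, b_j) for all j}`. -/
def box (e : HilbertBasis ℕ ℝ E) (a b : ℕ → ℝ) : Set E :=
  {x | ∀ j, ⟪e j, x⟫_ℝ ∈ Ico (a j) (b j)}

/-- The data of an absolutely measurable block. -/
structure Block (e : HilbertBasis ℕ ℝ E) where
  a : ℕ → ℝ
  b : ℕ → ℝ
  a_bdd : ∃ C, ∀ j, |a j| ≤ C
  b_bdd : ∃ C, ∀ j, |b j| ≤ C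
  lt : ∀ j, a j < b j
  abs : box e a b = ∅ ∨ Summable fun j => max 0 (Real.log (b j - a j))

variable {e : HilbertBasis ℕ ℝ E}

namespace Block

def toSet (Q : Block e) : Set E := box e Q.a Q.b

open Classical in
/-- The measure of an absolutely measurable block: the product of its edge lengths, or `0` if the
block is empty. -/
def vol (Q : Block e) : ℝ := if Q.toSet.Nonempty then ∏' j, (Q.b j - Q.a j) else 0

lemma tendsto_vol (Q : Block e) (hQ : Q.toSet ≠ ∅) :
    Tendsto (fun n => ∏ j ∈ Finset.range n, (Q.b j - Q.a j)) atTop (𝓝 Q.vol) := by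
  have hs : Summable fun j => max 0 (Real.log (Q.b j - Q.a j)) := Q.abs.resolve_left hQ
  have hpos : ∀ j, 0 < Q.b j - Q.a j := fun j => sub_pos.2 (Q.lt j)
  have h1 : Multipliable fun j => max 1 (Q.b j - Q.a j) := by
    refine Real.multipliable_of_summable_log (fun j => lt_max_of_lt_left one_pos) ?_
    refine hs.congr fun j => ?_
    rcases le_total 1 (Q.b j - Q.a j) with h | h
    · rw [max_eq_right h, max_eq_right (Real.log_nonneg h)]
    · rw [max_eq_left h, Real.log_one, max_eq_left (Real.log_nonpos (hpos j).le h)]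
  have h2 : Multipliable fun j => min 1 (Q.b j - Q.a j) := by
    refine ⟨_, tendsto_atTop_ciInf (f := fun s : Finset ℕ => ∏ j ∈ s, min 1 (Q.b j - Q.a j)) ?_ ?_⟩
    · intro s t hst
      have h0 : ∀ i, 0 ≤ min 1 (Q.b i - Q.a i) := fun i => (lt_min one_pos (hpos i)).le
      simp only
      rw [← Finset.prod_sdiff hst]
      exact mul_le_of_le_one_left (Finset.prod_nonneg fun i _ => h0 i)
        (Finset.prod_le_one (fun i _ => h0 i) fun i _ => min_le_left _ _)
    · exact ⟨0, by rintro _ ⟨s, rfl⟩; exact Finset.prod_nonneg fun i _ => (lt_min one_pos (hpos i)).le⟩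
  have h3 : Multipliable fun j => (Q.b j - Q.a j) := by
    refine (h1.mul h2).congr fun j => ?_
    rw [mul_comm, min_mul_max, one_mul]
  rw [vol, if_pos (nonempty_iff_ne_empty.2 hQ)]
  exact h3.hasProd.tendsto_prod_nat

end Block

lemma exists_repr_eq (z : ℕ → ℝ) (hz : Summable fun k => z k ^ 2) :
    ∃ x : E, ∀ k, ⟪e k, x⟫_ℝ = z k := by
  have hm : Memℓp z 2 := memℓp_gen (by simpa using hz)
  refine ⟨e.repr.symm ⟨z, hm⟩, fun k => ?_⟩
  rw [← e.repr_apply_apply, LinearIsometryEquiv.apply_symm_apply]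

lemma summable_coord_sq (x : E) : Summable fun k => ⟪e k, x⟫_ℝ ^ 2 := by
  simpa using e.orthonormal.inner_products_summable (x := x)

/-- Finitely many nonempty blocks whose edges have common points in every coordinate have a common
point. -/
lemma exists_common (S : Finset (Block e)) (hne : ∀ Q ∈ S, Q.toSet.Nonempty)
    (h : ∀ k, ∃ y, ∀ Q ∈ S, y ∈ Ico (Q.a k) (Q.b k)) : ∃ z : E, ∀ Q ∈ S, z ∈ Q.toSet := by
  classical
  rcases S.eq_empty_or_nonempty with rfl | hS
  · exact ⟨0, by simp⟩
  choose! p hp using hne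
  have key : ∀ k, ∃ y, (∀ Q ∈ S, y ∈ Ico (Q.a k) (Q.b k)) ∧ ∃ Q ∈ S, |y| ≤ |⟪e k, p Q⟫_ℝ| := by
    intro k
    obtain ⟨y, hy⟩ := h k
    obtain ⟨Q1, hQ1, h1⟩ := S.exists_max_image (fun Q => Q.a k) hS
    obtain ⟨Q2, hQ2, h2⟩ := S.exists_min_image (fun Q => ⟪e k, p Q⟫_ℝ) hS
    refine ⟨max (Q1.a k) ⟪e k, p Q2⟫_ℝ, fun Q hQ => ⟨(h1 Q hQ).trans (le_max_left _ _), ?_⟩, ?_⟩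
    · exact max_lt ((hy Q1 hQ1).1.trans_lt (hy Q hQ).2) ((h2 Q hQ).trans_lt (hp Q hQ k).2)
    · rcases le_total (Q1.a k) ⟪e k, p Q2⟫_ℝ with h | h
      · exact ⟨Q2, hQ2, by rw [max_eq_right h]⟩
      · rw [max_eq_left h]
        have h3 := (hp Q1 hQ1 k).1
        rcases le_total 0 (Q1.a k) with h4 | h4
        · exact ⟨Q1, hQ1, by rw [abs_of_nonneg h4, abs_of_nonneg (h4.trans h3)]; exact h3⟩
        · exact ⟨Q2, hQ2, by
            rw [abs_of_nonpos h4, abs_of_nonpos (h.trans h4)]; exact neg_le_neg h⟩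
  choose z hz hz' using key
  obtain ⟨x, hx⟩ := exists_repr_eq (e := e) z (by
    refine Summable.of_nonneg_of_le (fun k => sq_nonneg _) (fun k => ?_)
      (summable_sum (s := S) fun Q _ => summable_coord_sq (e := e) (p Q))
    obtain ⟨Q, hQ, h⟩ := hz' k
    exact (sq_le_sq.2 h).trans
      (Finset.single_le_sum (f := fun Q => ⟪e k, p Q⟫_ℝ ^ 2) (fun _ _ => sq_nonneg _) hQ))
  exact ⟨x, fun Q hQ k => by rw [hx]; exact hz k Q hQ⟩

/-- The first `n` edges of a block. -/
def box' (Q : Block e) (n : ℕ) : Set (Fin n → ℝ) := pi univ fun k : Fin n => Ico (Q.a k) (Q.b k)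

lemma posWeight_block : PosWeight (Block.toSet (e := e)) Block.vol := by
  classical
  intro s₀ c h₀
  -- discard the empty blocks
  set s := s₀.filter fun Q => Q.toSet ≠ ∅ with hs
  have hsum : ∑ Q ∈ s₀, c Q * Q.vol = ∑ Q ∈ s, c Q * Q.vol := by
    rw [hs, Finset.sum_filter]
    refine Finset.sum_congr rfl fun Q _ => ?_
    by_cases hQ : Q.toSet = ∅ <;> simp [hQ, Block.vol]
  have h : ∀ x, 0 ≤ ∑ Q ∈ s, c Q * Q.toSet.indicator 1 x := by
    intro x
    refine (h₀ x).trans_eq ?_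
    rw [hs, Finset.sum_filter]
    refine Finset.sum_congr rfl fun Q _ => ?_
    by_cases hQ : Q.toSet = ∅ <;> simp [hQ]
  have hne : ∀ Q ∈ s, Q.toSet ≠ ∅ := fun Q hQ => (Finset.mem_filter.1 hQ).2
  rw [hsum]
  -- a cut-off after which intersections of the finite dimensional boxes are nonempty only if the
  -- intersections of the blocks are
  have hev : ∀ᶠ n in atTop, ∀ S ∈ s.powerset,
      (∃ y : ℕ → ℝ, ∀ Q ∈ S, ∀ k < n, y k ∈ Ico (Q.a k) (Q.b k)) → ∃ z : E, ∀ Q ∈ S, z ∈ Q.toSet := by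
    rw [Filter.eventually_all_finset]
    intro S hS
    by_cases hz : ∃ z : E, ∀ Q ∈ S, z ∈ Q.toSet
    · exact Eventually.of_forall fun _ _ => hz
    · have : ¬ ∀ k, ∃ y, ∀ Q ∈ S, y ∈ Ico (Q.a k) (Q.b k) := fun h =>
        hz (exists_common S (fun Q hQ => nonempty_iff_ne_empty.2
          (hne Q (Finset.mem_powerset.1 hS hQ))) h)
      push Not at this
      obtain ⟨k, hk⟩ := this
      filter_upwards [eventually_gt_atTop k] with n hn
      rintro ⟨y, hy⟩
      obtain ⟨Q, hQ, hQ'⟩ := hk (y k)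
      exact (hQ' (hy Q hQ k hn)).elim
  have hlim : Tendsto (fun n => ∑ Q ∈ s, c Q * ∏ j ∈ Finset.range n, (Q.b j - Q.a j)) atTop
      (𝓝 (∑ Q ∈ s, c Q * Q.vol)) :=
    tendsto_finsetSum _ fun Q hQ => (Q.tendsto_vol (hne Q hQ)).const_mul _
  refine ge_of_tendsto hlim ?_
  filter_upwards [hev] with n hn
  have hpos : ∀ y : Fin n → ℝ, 0 ≤ ∑ Q ∈ s, c Q * (box' Q n).indicator 1 y := by
    intro y
    set y' : ℕ → ℝ := fun k => if hk : k < n then y ⟨k, hk⟩ else 0 with hy'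
    set S := s.filter fun Q => y ∈ box' Q n with hS
    obtain ⟨z, hz⟩ := hn S (Finset.mem_powerset.2 (Finset.filter_subset _ _)) ⟨y', by
      intro Q hQ k hk
      have := (Finset.mem_filter.1 hQ).2 ⟨k, hk⟩ (mem_univ _)
      simpa [hy', hk] using this⟩
    obtain ⟨x, hx⟩ := exists_repr_eq (e := e) (fun k => if k < n then y' k else ⟪e k, z⟫_ℝ) (by
      rw [← summable_nat_add_iff n]
      simpa using (summable_nat_add_iff n).2 (summable_coord_sq (e := e) z))
    refine (h x).trans_eq (Finset.sum_congr rfl fun Q hQ => ?_)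
    have hiff : x ∈ Q.toSet ↔ y ∈ box' Q n := by
      constructor
      · intro hxQ k _
        have := hxQ k
        rw [hx] at this
        simpa [hy'] using this
      · intro hyQ k
        rw [hx]
        by_cases hk : k < n
        · have := hyQ ⟨k, hk⟩ (mem_univ _)
          simpa [hk, hy'] using this
        · rw [if_neg hk]
          exact hz Q (Finset.mem_filter.2 ⟨hQ, hyQ⟩) k
    by_cases hyQ : y ∈ box' Q n
    · rw [indicator_of_mem hyQ, indicator_of_mem (hiff.2 hyQ)]; rfl
    · rw [indicator_of_notMem hyQ, indicator_of_notMem (fun h => hyQ (hiff.1 h))]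
  have hint : ∫ y : Fin n → ℝ, ∑ Q ∈ s, c Q * (box' Q n).indicator 1 y
      = ∑ Q ∈ s, c Q * ∏ j ∈ Finset.range n, (Q.b j - Q.a j) := by
    have hmeas : ∀ Q : Block e, MeasurableSet (box' Q n) := fun Q =>
      MeasurableSet.univ_pi fun k => measurableSet_Ico
    have hfin : ∀ Q : Block e, volume (box' Q n) ≠ ⊤ := fun Q => by
      rw [box', Real.volume_pi_Ico]
      exact ENNReal.prod_ne_top fun _ _ => ENNReal.ofReal_ne_top
    rw [integral_finsetSum]
    · refine Finset.sum_congr rfl fun Q _ => ?_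
      rw [integral_const_mul, integral_indicator_one (hmeas Q), Measure.real, box',
        Real.volume_pi_Ico_toReal (a := fun k : Fin n => Q.a k) (b := fun k : Fin n => Q.b k)
          (fun k => (Q.lt k).le), Finset.prod_range]
    · intro Q _
      refine Integrable.const_mul ?_ _
      exact (integrable_indicator_iff (hmeas Q)).2 (integrableOn_const (hfin Q))
  rw [← hint]
  exact integral_nonneg hpos

lemma mem_toSet {Q : Block e} {x : E} : x ∈ Q.toSet ↔ ∀ j, ⟪e j, x⟫_ℝ ∈ Ico (Q.a j) (Q.b j) :=
  Iff.rfl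

lemma box_one_two (e : HilbertBasis ℕ ℝ E) : box e (fun _ => 1) (fun _ => 2) = ∅ := by
  refine eq_empty_of_forall_notMem fun x hx => ?_
  have h1 := (summable_coord_sq (e := e) x).tendsto_atTop_zero
  have h2 : ∀ k, 1 ≤ ⟪e k, x⟫_ℝ ^ 2 := fun k => by
    have := (hx k).1
    nlinarith
  exact absurd (ge_of_tendsto' h1 h2) (by norm_num)

/-- An empty block. -/
def emptyBlock (e : HilbertBasis ℕ ℝ E) : Block e where
  a := fun _ => 1
  b := fun _ => 2
  a_bdd := ⟨1, by simp⟩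
  b_bdd := ⟨2, by simp⟩
  lt := by intro; norm_num
  abs := Or.inl (box_one_two e)

lemma emptyBlock_toSet : (emptyBlock e).toSet = ∅ := box_one_two e

lemma block_inter (Q W : Block e) : ∃ V : Block e, V.toSet = Q.toSet ∩ W.toSet := by
  by_cases hne : Q.toSet ∩ W.toSet = ∅
  · exact ⟨emptyBlock e, by rw [hne, emptyBlock_toSet]⟩
  obtain ⟨p, hp⟩ := nonempty_iff_ne_empty.2 hne
  have hlt : ∀ j, max (Q.a j) (W.a j) < min (Q.b j) (W.b j) := fun j =>
    (max_le (hp.1 j).1 (hp.2 j).1).trans_lt (lt_min (hp.1 j).2 (hp.2 j).2)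
  have hQ : Q.toSet ≠ ∅ := nonempty_iff_ne_empty.1 ⟨p, hp.1⟩
  refine ⟨⟨fun j => max (Q.a j) (W.a j), fun j => min (Q.b j) (W.b j), ?_, ?_, hlt, Or.inr ?_⟩, ?_⟩
  · obtain ⟨C, hC⟩ := Q.a_bdd
    obtain ⟨C', hC'⟩ := W.a_bdd
    exact ⟨max C C', fun j => abs_max_le_max_abs_abs.trans (max_le_max (hC j) (hC' j))⟩
  · obtain ⟨C, hC⟩ := Q.b_bdd
    obtain ⟨C', hC'⟩ := W.b_bdd
    exact ⟨max C C', fun j => abs_min_le_max_abs_abs.trans (max_le_max (hC j) (hC' j))⟩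
  · refine (Q.abs.resolve_left hQ).of_nonneg_of_le (fun j => le_max_left _ _) fun j => ?_
    exact max_le_max le_rfl (Real.log_le_log (sub_pos.2 (hlt j))
      (sub_le_sub (min_le_left _ _) (le_max_left _ _)))
  · ext x
    simp only [mem_inter_iff, mem_toSet, mem_Ico, max_le_iff, lt_min_iff]
    exact ⟨fun h => ⟨fun j => ⟨(h j).1.1, (h j).2.1⟩, fun j => ⟨(h j).1.2, (h j).2.2⟩⟩,
      fun h j => ⟨⟨(h.1 j).1, (h.2 j).1⟩, ⟨(h.1 j).2, (h.2 j).2⟩⟩⟩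

/-- The minimal ring of sets that contains all absolutely measurable blocks. -/
def blockRing (e : HilbertBasis ℕ ℝ E) : Set (Set E) :=
  {A | ∀ R : Set (Set E), IsSetRing R → (∀ Q : Block e, Q.toSet ∈ R) → A ∈ R}

lemma isSetRing_blockRing (e : HilbertBasis ℕ ℝ E) : IsSetRing (blockRing e) where
  empty_mem := fun _ hR _ => hR.empty_mem
  union_mem := fun _ _ hA hB R hR h => hR.union_mem (hA R hR h) (hB R hR h)
  sdiff_mem := fun _ _ hA hB R hR h => hR.sdiff_mem (hA R hR h) (hB R hR h)

lemma toSet_mem_blockRing (Q : Block e) : Q.toSet ∈ blockRing e := fun _ _ h => h Q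

/-- The indicator functions of the sets of the ring are linear combinations of those of blocks. -/
lemma ind_mem_of_blockRing {A : Set E} (hA : A ∈ blockRing e) :
    ind A ∈ simpleSpan (Block.toSet (e := e)) := by
  have hmul : ∀ {A B : Set E}, ind A ∈ simpleSpan (Block.toSet (e := e)) →
      ind B ∈ simpleSpan (Block.toSet (e := e)) →
      ind A * ind B ∈ simpleSpan (Block.toSet (e := e)) := fun hA hB => mul_mem block_inter hA hB
  refine hA {A | ind A ∈ simpleSpan (Block.toSet (e := e))} ⟨?_, ?_, ?_⟩ fun Q => ind_mem _ Q
  · have : ind (∅ : Set E) = 0 := by rw [ind, indicator_empty]; rfl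
    simp [this]
  · intro A B hA hB
    have : ind (A ∪ B) = ind A + ind B - ind A * ind B := by
      funext x
      by_cases h1 : x ∈ A <;> by_cases h2 : x ∈ B <;> simp [ind, h1, h2]
    change ind (A ∪ B) ∈ simpleSpan (Block.toSet (e := e))
    rw [this]
    exact Submodule.sub_mem _ (Submodule.add_mem _ hA hB) (hmul hA hB)
  · intro A B hA hB
    have : ind (A \ B) = ind A - ind A * ind B := by
      funext x
      by_cases h1 : x ∈ A <;> by_cases h2 : x ∈ B <;> simp [ind, h1, h2]
    change ind (A \ B) ∈ simpleSpan (Block.toSet (e := e))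
    rw [this]
    exact Submodule.sub_mem _ hA (hmul hA hB)

/-- The finitely additive extension of the volume of blocks to the ring `blockRing e`: if
`χ_A = ∑ cᵢ χ_{Qᵢ}` for blocks `Qᵢ`, then the measure of `A` is `∑ cᵢ vol Qᵢ`. -/
def blockMeasure (e : HilbertBasis ℕ ℝ E) (A : Set E) : ℝ :=
  (integ (Block.toSet (e := e)) Block.vol (ind A)).re

lemma blockMeasure_toSet (Q : Block e) : blockMeasure e Q.toSet = Q.vol := by
  rw [blockMeasure, integ_ind posWeight_block, Complex.ofReal_re]

lemma blockMeasure_union {A B : Set E} (hA : A ∈ blockRing e) (hB : B ∈ blockRing e)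
    (h : Disjoint A B) : blockMeasure e (A ∪ B) = blockMeasure e A + blockMeasure e B := by
  have : ind (A ∪ B) = ind A + ind B := by
    rw [ind, indicator_union_of_disjoint h]; rfl
  rw [blockMeasure, this, integ_add posWeight_block (ind_mem_of_blockRing hA)
    (ind_mem_of_blockRing hB)]
  rfl

lemma blockMeasure_empty : blockMeasure e ∅ = 0 := by
  have := blockMeasure_union (e := e) (isSetRing_blockRing e).empty_mem
    (isSetRing_blockRing e).empty_mem (disjoint_bot_left)
  simpa using this

lemma blockMeasure_nonneg {A : Set E} (hA : A ∈ blockRing e) : 0 ≤ blockMeasure e A :=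
  integ_re_nonneg posWeight_block (ind_mem_of_blockRing hA) fun x => by
    by_cases h : x ∈ A <;> simp [ind, h]

lemma blockMeasure_mono {A B : Set E} (hA : A ∈ blockRing e) (hB : B ∈ blockRing e)
    (h : A ⊆ B) : blockMeasure e B = blockMeasure e A + blockMeasure e (B \ A) := by
  rw [← blockMeasure_union hA ((isSetRing_blockRing e).sdiff_mem hB hA) disjoint_sdiff_right,
    union_sdiff_cancel h]

lemma blockMeasure_le {A B : Set E} (hA : A ∈ blockRing e) (hB : B ∈ blockRing e)
    (h : A ⊆ B) : blockMeasure e A ≤ blockMeasure e B := by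
  rw [blockMeasure_mono hA hB h]
  linarith [blockMeasure_nonneg ((isSetRing_blockRing e).sdiff_mem hB hA)]

lemma blockMeasure_union_le {A B : Set E} (hA : A ∈ blockRing e) (hB : B ∈ blockRing e) :
    blockMeasure e (A ∪ B) ≤ blockMeasure e A + blockMeasure e B := by
  have hR := isSetRing_blockRing e
  rw [← union_sdiff_self, blockMeasure_union hA (hR.sdiff_mem hB hA) disjoint_sdiff_right]
  linarith [blockMeasure_le (hR.sdiff_mem hB hA) hB sdiff_subset]

/-- The completion of the ring: the sets that are enclosed between sets of the ring whose
difference has arbitrarily small measure. -/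
def measRing (e : HilbertBasis ℕ ℝ E) : Set (Set E) :=
  {A | ∀ ε > 0, ∃ B ∈ blockRing e, ∃ C ∈ blockRing e,
    B ⊆ A ∧ A ⊆ C ∧ blockMeasure e (C \ B) < ε}

/-- The measure `λ` on the completed ring. -/
def lam (e : HilbertBasis ℕ ℝ E) (A : Set E) : ℝ :=
  sSup {r | ∃ B ∈ blockRing e, B ⊆ A ∧ r = blockMeasure e B}

lemma blockRing_subset_measRing : blockRing e ⊆ measRing e := fun A hA ε hε =>
  ⟨A, hA, A, hA, Subset.rfl, Subset.rfl, by rw [sdiff_self]; exact blockMeasure_empty.trans_lt hε⟩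

lemma isSetRing_measRing (e : HilbertBasis ℕ ℝ E) : IsSetRing (measRing e) where
  empty_mem := blockRing_subset_measRing (isSetRing_blockRing e).empty_mem
  union_mem := by
    intro A₁ A₂ h₁ h₂ ε hε
    have hR := isSetRing_blockRing e
    obtain ⟨B₁, hB₁, C₁, hC₁, hBA₁, hAC₁, hl₁⟩ := h₁ (ε / 2) (half_pos hε)
    obtain ⟨B₂, hB₂, C₂, hC₂, hBA₂, hAC₂, hl₂⟩ := h₂ (ε / 2) (half_pos hε)
    refine ⟨_, hR.union_mem hB₁ hB₂, _, hR.union_mem hC₁ hC₂, union_subset_union hBA₁ hBA₂,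
      union_subset_union hAC₁ hAC₂, ?_⟩
    have h1 := blockMeasure_le
      (hR.sdiff_mem (hR.union_mem hC₁ hC₂) (hR.union_mem hB₁ hB₂))
      (hR.union_mem (hR.sdiff_mem hC₁ hB₁) (hR.sdiff_mem hC₂ hB₂))
      (by
        rintro x ⟨hx | hx, hx'⟩
        · exact Or.inl ⟨hx, fun h => hx' (Or.inl h)⟩
        · exact Or.inr ⟨hx, fun h => hx' (Or.inr h)⟩)
    have h2 := blockMeasure_union_le (hR.sdiff_mem hC₁ hB₁) (hR.sdiff_mem hC₂ hB₂)
    linarith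
  sdiff_mem := by
    intro A₁ A₂ h₁ h₂ ε hε
    have hR := isSetRing_blockRing e
    obtain ⟨B₁, hB₁, C₁, hC₁, hBA₁, hAC₁, hl₁⟩ := h₁ (ε / 2) (half_pos hε)
    obtain ⟨B₂, hB₂, C₂, hC₂, hBA₂, hAC₂, hl₂⟩ := h₂ (ε / 2) (half_pos hε)
    refine ⟨_, hR.sdiff_mem hB₁ hC₂, _, hR.sdiff_mem hC₁ hB₂, sdiff_subset_sdiff hBA₁ hAC₂,
      sdiff_subset_sdiff hAC₁ hBA₂, ?_⟩
    have h1 := blockMeasure_le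
      (hR.sdiff_mem (hR.sdiff_mem hC₁ hB₂) (hR.sdiff_mem hB₁ hC₂))
      (hR.union_mem (hR.sdiff_mem hC₁ hB₁) (hR.sdiff_mem hC₂ hB₂))
      (by
        rintro x ⟨⟨h1, h2⟩, h3⟩
        by_cases h4 : x ∈ B₁
        · exact Or.inr ⟨by_contra fun h5 => h3 ⟨h4, h5⟩, h2⟩
        · exact Or.inl ⟨h1, h4⟩)
    have h2 := blockMeasure_union_le (hR.sdiff_mem hC₁ hB₁) (hR.sdiff_mem hC₂ hB₂)
    linarith

lemma lam_bounds {A B C : Set E} (hB : B ∈ blockRing e) (hC : C ∈ blockRing e) (hBA : B ⊆ A)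
    (hAC : A ⊆ C) : blockMeasure e B ≤ lam e A ∧ lam e A ≤ blockMeasure e C := by
  have hle : ∀ r ∈ {r | ∃ B ∈ blockRing e, B ⊆ A ∧ r = blockMeasure e B}, r ≤ blockMeasure e C := by
    rintro _ ⟨B', hB', hBA', rfl⟩
    exact blockMeasure_le hB' hC (hBA'.trans hAC)
  exact ⟨le_csSup ⟨_, hle⟩ ⟨B, hB, hBA, rfl⟩, csSup_le ⟨_, B, hB, hBA, rfl⟩ hle⟩

lemma lam_eq {A : Set E} (hA : A ∈ blockRing e) : lam e A = blockMeasure e A :=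
  have h := lam_bounds hA hA Subset.rfl Subset.rfl
  le_antisymm h.2 h.1

lemma lam_nonneg {A : Set E} (hA : A ∈ measRing e) : 0 ≤ lam e A := by
  obtain ⟨B, hB, C, hC, hBA, hAC, -⟩ := hA 1 one_pos
  exact (blockMeasure_nonneg hB).trans (lam_bounds hB hC hBA hAC).1

lemma lam_union {A₁ A₂ : Set E} (h₁ : A₁ ∈ measRing e) (h₂ : A₂ ∈ measRing e)
    (hd : Disjoint A₁ A₂) : lam e (A₁ ∪ A₂) = lam e A₁ + lam e A₂ := by
  have hR := isSetRing_blockRing e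
  refine eq_of_forall_dist_le fun ε hε => ?_
  obtain ⟨B₁, hB₁, C₁, hC₁, hBA₁, hAC₁, hl₁⟩ := h₁ (ε / 2) (half_pos hε)
  obtain ⟨B₂, hB₂, C₂, hC₂, hBA₂, hAC₂, hl₂⟩ := h₂ (ε / 2) (half_pos hε)
  have e₁ := lam_bounds hB₁ hC₁ hBA₁ hAC₁
  have e₂ := lam_bounds hB₂ hC₂ hBA₂ hAC₂
  have e₃ := lam_bounds (hR.union_mem hB₁ hB₂) (hR.union_mem hC₁ hC₂)
    (union_subset_union hBA₁ hBA₂) (union_subset_union hAC₁ hAC₂)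
  rw [blockMeasure_union hB₁ hB₂ (hd.mono hBA₁ hBA₂)] at e₃
  have e₄ := blockMeasure_union_le hC₁ hC₂
  rw [blockMeasure_mono hB₁ hC₁ (hBA₁.trans hAC₁)] at e₁ e₄
  rw [blockMeasure_mono hB₂ hC₂ (hBA₂.trans hAC₂)] at e₂ e₄
  rw [Real.dist_eq, abs_le]
  constructor <;> linarith [e₁.1, e₁.2, e₂.1, e₂.2, e₃.1, e₃.2]

lemma posWeight_lam :
    PosWeight (fun A : measRing e => (A : Set E)) (fun A : measRing e => lam e A) :=
  posWeight_of_additive (isSetRing_measRing e) (lam e)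
    ((lam_eq (isSetRing_blockRing e).empty_mem).trans blockMeasure_empty)
    (fun _ hA => lam_nonneg hA) (fun _ hA _ hB h => lam_union hA hB h)

/-- The space of simple functions: linear combinations of the indicator functions of sets of the
completed ring. -/
def Simple (e : HilbertBasis ℕ ℝ E) : Type _ :=
  simpleSpan (fun A : measRing e => (A : Set E))

instance : AddCommGroup (Simple e) :=
  inferInstanceAs (AddCommGroup (simpleSpan (fun A : measRing e => (A : Set E))))

instance : Module ℂ (Simple e) :=
  inferInstanceAs (Module ℂ (simpleSpan (fun A : measRing e => (A : Set E))))

/-- A simple function as a function on `E`. -/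
def Simple.fn (f : Simple e) : E → ℂ := Subtype.val f

lemma Simple.fn_mem (f : Simple e) : f.fn ∈ simpleSpan (fun A : measRing e => (A : Set E)) :=
  Subtype.property f

lemma Simple.fn_add (f g : Simple e) : (f + g).fn = f.fn + g.fn := rfl

lemma Simple.fn_smul (z : ℂ) (f : Simple e) : (z • f).fn = z • f.fn := rfl

/-- The integral with respect to `λ` of a simple function. -/
def lamInteg (e : HilbertBasis ℕ ℝ E) (f : E → ℂ) : ℂ :=
  integ (fun A : measRing e => (A : Set E)) (fun A : measRing e => lam e A) f

lemma Simple.conj_mul_mem (f g : Simple e) :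
    (fun x => conj (f.fn x) * g.fn x) ∈ simpleSpan (fun A : measRing e => (A : Set E)) :=
  mul_mem (fun A B => ⟨⟨A ∩ B, (isSetRing_measRing e).inter_mem A.2 B.2⟩, rfl⟩)
    (conj_mem f.fn_mem) g.fn_mem

/-- The positive semidefinite form `∫ conj f · g dλ` on simple functions. -/
instance simpleCore : PreInnerProductSpace.Core ℂ (Simple e) where
  inner f g := lamInteg e fun x => conj (f.fn x) * g.fn x
  conj_inner_symm f g := by
    rw [lamInteg, lamInteg, ← integ_conj posWeight_lam (g.conj_mul_mem f)]
    congr 1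
    funext x
    simp [mul_comm]
  re_inner_nonneg f := by
    refine integ_re_nonneg posWeight_lam (f.conj_mul_mem f) fun x => ?_
    rw [← Complex.normSq_eq_conj_mul_self, Complex.ofReal_re]
    exact Complex.normSq_nonneg _
  add_left f g h := by
    rw [lamInteg, lamInteg, lamInteg, ← integ_add posWeight_lam (f.conj_mul_mem h)
      (g.conj_mul_mem h)]
    congr 1
    funext x
    simp [Simple.fn_add, add_mul]
  smul_left f g z := by
    rw [lamInteg, lamInteg, ← integ_smul posWeight_lam _ (f.conj_mul_mem g)]
    congr 1
    funext x
    simp [Simple.fn_smul, mul_assoc]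

instance : SeminormedAddCommGroup (Simple e) :=
  InnerProductSpace.Core.toSeminormedAddCommGroup (𝕜 := ℂ)

instance : InnerProductSpace ℂ (Simple e) := InnerProductSpace.ofCore simpleCore

lemma Simple.inner_def (f g : Simple e) :
    ⟪f, g⟫_ℂ = lamInteg e fun x => conj (f.fn x) * g.fn x := rfl

/-- The Hilbert space of square integrable functions with respect to `λ`: the completion of the
simple functions modulo the functions of norm zero. -/
abbrev L2 (e : HilbertBasis ℕ ℝ E) : Type _ := UniformSpace.Completion (Simple e)

/-! Shifts. -/

lemma integ_comp {α ι : Type*} {A : ι → Set α} {w : ι → ℝ} (hw : PosWeight A w) (T : α → α)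
    (φ : ι → ι) (hA : ∀ i, A (φ i) = T ⁻¹' A i) (hφ : ∀ i, w (φ i) = w i) {f : α → ℂ}
    (hf : f ∈ simpleSpan A) : f ∘ T ∈ simpleSpan A ∧ integ A w (f ∘ T) = integ A w f := by
  obtain ⟨c, rfl⟩ := mem_simpleSpan.1 hf
  have h1 : comb A (c.mapDomain φ) = comb A c ∘ T := by
    funext x
    rw [Function.comp_apply, comb_apply A c (T x)]
    simp only [comb]
    rw [Finsupp.linearCombination_mapDomain, Finsupp.linearCombination_apply, Finsupp.sum,
      Finset.sum_apply]
    refine Finset.sum_congr rfl fun i _ => ?_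
    simp only [Function.comp_apply, Pi.smul_apply, hA]
    rfl
  have h2 : wsum w (c.mapDomain φ) = wsum w c := by
    simp only [wsum]
    rw [Finsupp.linearCombination_mapDomain]
    congr 2
    funext i
    simp [hφ]
  exact ⟨mem_simpleSpan.2 ⟨_, h1⟩, by rw [← h1, integ_comb hw, integ_comb hw, h2]⟩

/-- The shifted set `A + h`. -/
def translate (h : E) (A : Set E) : Set E := (fun x => x - h) ⁻¹' A

lemma box_translate (a b : ℕ → ℝ) (h : E) :
    box e (fun j => a j + ⟪e j, h⟫_ℝ) (fun j => b j + ⟪e j, h⟫_ℝ) = translate h (box e a b) := by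
  ext x
  simp only [box, translate, mem_ofPred_eq, mem_preimage, inner_sub_right, mem_Ico,
    le_sub_iff_add_le, sub_lt_iff_lt_add]

lemma abs_coord_le (h : E) (j : ℕ) : |⟪e j, h⟫_ℝ| ≤ ‖h‖ := by
  simpa [e.orthonormal.1 j] using abs_real_inner_le_norm (e j) h

/-- The shifted block. -/
def Block.translate (h : E) (Q : Block e) : Block e where
  a := fun j => Q.a j + ⟪e j, h⟫_ℝ
  b := fun j => Q.b j + ⟪e j, h⟫_ℝ
  a_bdd := by
    obtain ⟨C, hC⟩ := Q.a_bdd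
    exact ⟨C + ‖h‖, fun j => (abs_add_le _ _).trans (add_le_add (hC j) (abs_coord_le h j))⟩
  b_bdd := by
    obtain ⟨C, hC⟩ := Q.b_bdd
    exact ⟨C + ‖h‖, fun j => (abs_add_le _ _).trans (add_le_add (hC j) (abs_coord_le h j))⟩
  lt := fun j => add_lt_add_left (Q.lt j) _
  abs := by
    rw [box_translate]
    refine Q.abs.imp (fun h0 => by rw [h0]; rfl) fun hs => hs.congr fun j => ?_
    rw [add_sub_add_right_eq_sub]

lemma Block.toSet_translate (h : E) (Q : Block e) :
    (Q.translate h).toSet = ShiftAvg.translate h Q.toSet := box_translate _ _ _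

lemma Block.vol_translate (h : E) (Q : Block e) : (Q.translate h).vol = Q.vol := by
  have hne : (Q.translate h).toSet.Nonempty ↔ Q.toSet.Nonempty := by
    rw [Block.toSet_translate]
    exact ⟨fun ⟨x, hx⟩ => ⟨x - h, hx⟩, fun ⟨x, hx⟩ => ⟨x + h, by
      change x + h - h ∈ Q.toSet
      rwa [add_sub_cancel_right]⟩⟩
  have hsub : ∀ j, (Q.translate h).b j - (Q.translate h).a j = Q.b j - Q.a j := fun j =>
    add_sub_add_right_eq_sub _ _ _
  by_cases h0 : Q.toSet.Nonempty
  · rw [Block.vol, Block.vol, if_pos h0, if_pos (hne.2 h0)]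
    exact tprod_congr hsub
  · rw [Block.vol, Block.vol, if_neg h0, if_neg (mt hne.1 h0)]

lemma translate_mem_blockRing (h : E) {A : Set E} (hA : A ∈ blockRing e) :
    translate h A ∈ blockRing e := by
  have hR := isSetRing_blockRing e
  refine hA {A | translate h A ∈ blockRing e} ⟨hR.empty_mem, fun A B hA hB => hR.union_mem hA hB,
    fun A B hA hB => hR.sdiff_mem hA hB⟩ fun Q => ?_
  change translate h Q.toSet ∈ blockRing e
  rw [← Block.toSet_translate]
  exact toSet_mem_blockRing _

lemma blockMeasure_translate (h : E) {A : Set E} (hA : A ∈ blockRing e) :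
    blockMeasure e (translate h A) = blockMeasure e A := by
  rw [blockMeasure, blockMeasure, ← (integ_comp posWeight_block (fun x => x - h)
    (Block.translate h) (Block.toSet_translate h) (Block.vol_translate h)
    (ind_mem_of_blockRing hA)).2]
  rfl

lemma translate_mem_measRing (h : E) {A : Set E} (hA : A ∈ measRing e) :
    translate h A ∈ measRing e := fun ε hε => by
  obtain ⟨B, hB, C, hC, hBA, hAC, hl⟩ := hA ε hε
  exact ⟨_, translate_mem_blockRing h hB, _, translate_mem_blockRing h hC, preimage_mono hBA,
    preimage_mono hAC, (blockMeasure_translate h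
      ((isSetRing_blockRing e).sdiff_mem hC hB)).trans_lt hl⟩

lemma lam_translate (h : E) {A : Set E} (hA : A ∈ measRing e) :
    lam e (translate h A) = lam e A := by
  refine eq_of_forall_dist_le fun ε hε => ?_
  obtain ⟨B, hB, C, hC, hBA, hAC, hl⟩ := hA ε hε
  have h1 := lam_bounds hB hC hBA hAC
  have h2 := lam_bounds (A := translate h A) (translate_mem_blockRing h hB)
    (translate_mem_blockRing h hC) (preimage_mono hBA) (preimage_mono hAC)
  rw [blockMeasure_translate h hB, blockMeasure_translate h hC] at h2
  rw [blockMeasure_mono hB hC (hBA.trans hAC)] at h1 h2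
  rw [Real.dist_eq, abs_le]
  constructor <;> linarith [h1.1, h1.2, h2.1, h2.2]

lemma integ_translate (h : E) {f : E → ℂ}
    (hf : f ∈ simpleSpan (fun A : measRing e => (A : Set E))) :
    (fun x => f (x - h)) ∈ simpleSpan (fun A : measRing e => (A : Set E)) ∧
      lamInteg e (fun x => f (x - h)) = lamInteg e f :=
  integ_comp posWeight_lam (fun x => x - h)
    (fun A : measRing e => ⟨translate h A, translate_mem_measRing h A.2⟩) (fun _ => rfl)
    (fun A => lam_translate h A.2) hf

/-- The shift `f ↦ f (· - h)` on simple functions. -/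
def Simple.shift (e : HilbertBasis ℕ ℝ E) (h : E) : Simple e →ₗᵢ[ℂ] Simple e where
  toFun f := ⟨fun x => f.fn (x - h), (integ_translate h f.fn_mem).1⟩
  map_add' _ _ := rfl
  map_smul' _ _ := rfl
  norm_map' f := by
    rw [norm_eq_sqrt_re_inner (𝕜 := ℂ), norm_eq_sqrt_re_inner (𝕜 := ℂ), Simple.inner_def,
      Simple.inner_def]
    congr 2
    exact (integ_translate h (f.conj_mul_mem f)).2

/-- The shift operator `S_h f(x) = f(x - h)` on the Hilbert space of square integrable functions. -/
def shift (e : HilbertBasis ℕ ℝ E) (h : E) : L2 e →L[ℂ] L2 e :=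
  (Simple.shift e h).toContinuousLinearMap.completion

variable [MeasurableSpace E]

/-- `U` is the Pettis integral `∫ S_h dν(h)` of the shift operators: the functions
`h ↦ (g, S_h f)` are `ν`-integrable, with integral `(g, U f)`. -/
def IsShiftAverage (e : HilbertBasis ℕ ℝ E) (ν : Measure E) (U : L2 e →L[ℂ] L2 e) : Prop :=
  ∀ f g : L2 e, Integrable (fun h => ⟪g, shift e h f⟫_ℂ) ν ∧
    ∫ h, ⟪g, shift e h f⟫_ℂ ∂ν = ⟪g, U f⟫_ℂ

open Classical in
/-- The Pettis integral `∫ S_h dν(h)` of the shift operators (and `0` if it does not exist). -/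
def shiftAverage (e : HilbertBasis ℕ ℝ E) (ν : Measure E) : L2 e →L[ℂ] L2 e :=
  if h : ∃ U, IsShiftAverage e ν U then h.choose else 0

/-- The law of `∑ ξ_k e_k`, where the `ξ_k` are independent centered Gaussian random variables with
variances `(D e_k, e_k)`: for nonnegative nuclear `D` that is diagonal in the basis `e`, this is the
centered Gaussian measure with covariance operator `D`. -/
def gaussianMeasure (e : HilbertBasis ℕ ℝ E) (D : E →L[ℝ] E) : Measure E :=
  (Measure.infinitePi fun k : ℕ => gaussianReal 0 (⟪D (e k), e k⟫_ℝ).toNNReal).map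
    fun ξ => ∑' k, ξ k • e k

/-- `ν` is the centered Gaussian measure with covariance operator `D`: a probability measure with
characteristic function `exp (-(D ξ, ξ) / 2)`. -/
def IsCenteredGaussian (ν : Measure E) (D : E →L[ℝ] E) : Prop :=
  IsProbabilityMeasure ν ∧ ∀ ξ : E, charFun ν ξ = Complex.exp (-((⟪D ξ, ξ⟫_ℝ / 2 : ℝ) : ℂ))

/-- The operator `U_D = ∫ S_h dν_D(h)`. -/
def gaussianAverage (e : HilbertBasis ℕ ℝ E) (D : E →L[ℝ] E) : L2 e →L[ℂ] L2 e :=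
  shiftAverage e (gaussianMeasure e D)

/-- A nuclear operator: `T z = ∑ (x_n, z) y_n` with `∑ ‖x_n‖ ‖y_n‖ < ∞`. -/
def IsNuclear (T : E →L[ℝ] E) : Prop :=
  ∃ x y : ℕ → E, (Summable fun n => ‖x n‖ * ‖y n‖) ∧
    ∀ z, HasSum (fun n => ⟪x n, z⟫_ℝ • y n) (T z)

/-- The orthogonal projection onto the span of the first `m` basis vectors. -/
def coordProj (e : HilbertBasis ℕ ℝ E) (m : ℕ) : E →L[ℝ] E :=
  ∑ k ∈ Finset.range m, (innerSL ℝ (e k)).smulRight (e k)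

end Content

end ShiftAvg

end

/-!
The matrix coefficients of the shifts are explicit on the indicator functions of blocks: if `Q` and
`W` are nonempty blocks, then `(χ_Q, S_h χ_W)` is the limit of the products of the lengths of the
intersections of the edges of `Q` and `W + h` (`tendsto_blockMeasure_inter`). Since the linear
combinations of these indicator functions are dense (`dense_span_blockVec`), all the functions
`h ↦ (g, S_h f)` are measurable (`measurable_inner_shift`), and they are bounded by `‖g‖ ‖f‖`. Hence
the average `U_ν` of the shifts exists for every probability measure `ν`, it is a contraction, and
`U_{μ ∗ ν} = U_μ U_ν` (`shiftAverage_conv`).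

A contraction `U` satisfies `‖U f - f‖² ≤ 2 (‖f‖² - Re (f, U f))`. For `f = χ_Q` with a block `Q` of
nonzero measure and with edge lengths `ℓ_j`,
`(f, S_h f) = λ(Q) ∏ max (0, 1 - |h_j| / ℓ_j) ≥ λ(Q) (1 - ∑ |h_j| / ℓ_j)`,
where the `ℓ_j` are bounded away from `0` because their product converges to a nonzero number. For a
Gaussian measure with independent coordinates the mean value of `|h_j|` is at most the standard
deviation `σ_j`, so that `‖U f - f‖²` is at most a multiple of `∑ σ_j`. By density the averages
converge strongly to the identity as `∑ σ_j → 0` (`exists_norm_shiftAverage_sub_lt`).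

Nuclearity of `D^{1/2}` says that the numbers `√d_k`, where the `d_k` are the eigenvalues of `D`,
are summable (`IsNuclear.summable_abs_inner`, `sqrt_apply_eigenvector`). Adding independent Gaussian
variables adds covariances (`diagGaussian_add`), so that `U_{A + B} = U_A U_B` for diagonal
operators. In particular `U_{tD} f - U_{tD_m} f = U_{tD_m} (U_{tD - tD_m} f - f)` has at most the norm of
`U_{tD - tD_m} f - f`, and the standard deviations for `tD - tD_m` sum to `√t ∑_{k ≥ m} √d_k`, which
tends to `0` uniformly for bounded `t`. Likewise `U_{tD} f - U_{sD} f` with `s ≤ t` has at most the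
norm of `U_{(t - s)D} f - f`, and here the standard deviations sum to `√(t - s) ∑ √d_k`.
-/

namespace ShiftAvg

variable {E : Type*} [NormedAddCommGroup E] [InnerProductSpace ℝ E] {e : HilbertBasis ℕ ℝ E}

/-! ### Indicator functions as vectors -/

/-- The indicator function of a set of the completed ring, as a simple function. -/
noncomputable def simpleInd (e : HilbertBasis ℕ ℝ E) (A : Set E) (hA : A ∈ measRing e) : Simple e :=
  ⟨ind A, ind_mem (fun A : measRing e => (A : Set E)) ⟨A, hA⟩⟩

lemma fn_simpleInd {A : Set E} (hA : A ∈ measRing e) : (simpleInd e A hA).fn = ind A := rfl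

lemma lamInteg_ind {A : Set E} (hA : A ∈ measRing e) : lamInteg e (ind A) = lam e A :=
  integ_ind posWeight_lam (⟨A, hA⟩ : measRing e)

lemma inner_simpleInd {A B : Set E} (hA : A ∈ measRing e) (hB : B ∈ measRing e) :
    ⟪simpleInd e A hA, simpleInd e B hB⟫_ℂ = lam e (A ∩ B) := by
  rw [Simple.inner_def, ← lamInteg_ind ((isSetRing_measRing e).inter_mem hA hB)]
  congr 1
  funext x
  by_cases h1 : x ∈ A <;> by_cases h2 : x ∈ B <;> simp [fn_simpleInd, ind, h1, h2]

lemma toSet_mem_measRing (Q : Block e) : Q.toSet ∈ measRing e :=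
  blockRing_subset_measRing (toSet_mem_blockRing Q)

/-- The indicator function of an absolutely measurable block, as a vector of the Hilbert space. -/
noncomputable def blockVec (Q : Block e) : L2 e :=
  (simpleInd e Q.toSet (toSet_mem_measRing Q) : Simple e)

lemma shift_blockVec (h : E) (Q : Block e) :
    shift e h (blockVec Q) = blockVec (Q.translate h) := by
  rw [shift, blockVec, ContinuousLinearMap.completion_apply_coe, blockVec]
  congr 1
  apply Subtype.ext
  change _ = ind (Q.translate h).toSet
  rw [Block.toSet_translate]
  rfl

lemma inner_blockVec (Q W : Block e) :
    ⟪blockVec Q, blockVec W⟫_ℂ = blockMeasure e (Q.toSet ∩ W.toSet) := by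
  rw [blockVec, blockVec, UniformSpace.Completion.inner_coe, inner_simpleInd, lam_eq]
  exact (isSetRing_blockRing e).inter_mem (toSet_mem_blockRing Q) (toSet_mem_blockRing W)

lemma norm_blockVec_sq (Q : Block e) : ‖blockVec Q‖ ^ 2 = Q.vol := by
  have h := inner_blockVec Q Q
  rw [inter_self, blockMeasure_toSet, inner_self_eq_norm_sq_to_K] at h
  exact Complex.ofReal_injective (by rw [← h]; push_cast; rfl)

/-- The measure of the intersection of two nonempty blocks is the product of the lengths of the
intersections of their edges. -/
lemma tendsto_blockMeasure_inter {Q W : Block e} (hQ : Q.toSet.Nonempty) (hW : W.toSet.Nonempty) :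
    Tendsto (fun n => ∏ j ∈ Finset.range n,
      max 0 (min (Q.b j) (W.b j) - max (Q.a j) (W.a j))) atTop
      (𝓝 (blockMeasure e (Q.toSet ∩ W.toSet))) := by
  classical
  by_cases hlt : ∀ j, max (Q.a j) (W.a j) < min (Q.b j) (W.b j)
  · obtain ⟨z, hz⟩ := exists_common {Q, W} (by simp [hQ, hW]) fun k =>
      ⟨max (Q.a k) (W.a k), by
        have h := hlt k
        rw [lt_min_iff] at h
        simp only [Finset.mem_insert, Finset.mem_singleton, forall_eq_or_imp, forall_eq, mem_Ico]
        exact ⟨⟨le_max_left _ _, h.1⟩, ⟨le_max_right _ _, h.2⟩⟩⟩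
    obtain ⟨V, hV, ha, hb⟩ : ∃ V : Block e, V.toSet = Q.toSet ∩ W.toSet ∧
        (∀ j, V.a j = max (Q.a j) (W.a j)) ∧ ∀ j, V.b j = min (Q.b j) (W.b j) := by
      refine ⟨⟨fun j => max (Q.a j) (W.a j), fun j => min (Q.b j) (W.b j), ?_, ?_, hlt,
        Or.inr ?_⟩, ?_, fun _ => rfl, fun _ => rfl⟩
      · obtain ⟨C, hC⟩ := Q.a_bdd
        obtain ⟨C', hC'⟩ := W.a_bdd
        exact ⟨max C C', fun j => abs_max_le_max_abs_abs.trans (max_le_max (hC j) (hC' j))⟩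
      · obtain ⟨C, hC⟩ := Q.b_bdd
        obtain ⟨C', hC'⟩ := W.b_bdd
        exact ⟨max C C', fun j => abs_min_le_max_abs_abs.trans (max_le_max (hC j) (hC' j))⟩
      · refine (Q.abs.resolve_left hQ.ne_empty).of_nonneg_of_le (fun j => le_max_left _ _)
          fun j => ?_
        exact max_le_max le_rfl (Real.log_le_log (sub_pos.2 (hlt j))
          (sub_le_sub (min_le_left _ _) (le_max_left _ _)))
      · ext x
        simp only [mem_inter_iff, mem_toSet, mem_Ico, max_le_iff, lt_min_iff]
        exact ⟨fun h => ⟨fun j => ⟨(h j).1.1, (h j).2.1⟩, fun j => ⟨(h j).1.2, (h j).2.2⟩⟩,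
          fun h j => ⟨⟨(h.1 j).1, (h.2 j).1⟩, ⟨(h.1 j).2, (h.2 j).2⟩⟩⟩
    have hne : V.toSet ≠ ∅ := by
      rw [hV]
      exact nonempty_iff_ne_empty.1 ⟨z, hz Q (by simp), hz W (by simp)⟩
    rw [← hV, blockMeasure_toSet]
    refine (V.tendsto_vol hne).congr fun n => Finset.prod_congr rfl fun j _ => ?_
    rw [ha, hb, max_eq_right (sub_pos.2 (hlt j)).le]
  · push Not at hlt
    obtain ⟨k, hk⟩ := hlt
    have hempty : Q.toSet ∩ W.toSet = ∅ := by
      refine eq_empty_of_forall_notMem fun x hx => ?_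
      have h1 := hx.1 k
      have h2 := hx.2 k
      exact absurd (hk.trans (max_le h1.1 h2.1)) (not_le.2 (lt_min h1.2 h2.2))
    rw [hempty, blockMeasure_empty]
    refine tendsto_const_nhds.congr' ?_
    filter_upwards [eventually_gt_atTop k] with n hn
    refine (Finset.prod_eq_zero (i := k) (Finset.mem_range.2 hn) ?_).symm
    exact max_eq_left (sub_nonpos.2 hk)

lemma blockVec_eq_zero_of_empty {Q : Block e} (hQ : Q.toSet = ∅) : blockVec Q = 0 := by
  have h := norm_blockVec_sq Q
  rw [Block.vol, if_neg (by simp [hQ])] at h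
  simpa using h

/-- The linear combinations of indicator functions of blocks are dense. -/
lemma dense_span_blockVec :
    (Submodule.span ℂ (range (blockVec (e := e)))).topologicalClosure = ⊤ := by
  set V := (Submodule.span ℂ (range (blockVec (e := e)))).topologicalClosure with hV
  have hle : Submodule.span ℂ (range (blockVec (e := e))) ≤ V := Submodule.le_topologicalClosure _
  have hVc : IsClosed (V : Set (L2 e)) := Submodule.isClosed_topologicalClosure _
  -- vectors represented by linear combinations of blocks
  have h1 : ∀ f : Simple e, f.fn ∈ simpleSpan (Block.toSet (e := e)) → (f : L2 e) ∈ V := by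
    intro f hf
    obtain ⟨c, hc⟩ := mem_simpleSpan.1 hf
    have : f = ∑ Q ∈ c.support, c Q • simpleInd e Q.toSet (toSet_mem_measRing Q) := by
      apply Subtype.ext
      change f.fn = (simpleSpan (fun A : measRing e => (A : Set E))).subtype
        (∑ Q ∈ c.support, c Q • simpleInd e Q.toSet (toSet_mem_measRing Q) : Simple e)
      erw [map_sum]
      rw [← hc, comb, Finsupp.linearCombination_apply, Finsupp.sum]
      rfl
    rw [this]
    refine hle ?_
    change UniformSpace.Completion.toComplL (𝕜 := ℂ) (∑ Q ∈ c.support, _) ∈ _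
    rw [map_sum]
    refine Submodule.sum_mem _ fun Q _ => ?_
    rw [map_smul]
    exact Submodule.smul_mem _ _ (Submodule.subset_span ⟨Q, rfl⟩)
  have h2 : ∀ A (hA : A ∈ measRing e), (simpleInd e A hA : L2 e) ∈ V := by
    intro A hA
    refine hVc.closure_subset (Metric.mem_closure_iff.2 fun ε hε => ?_)
    obtain ⟨B, hB, C, hC, hBA, hAC, hl⟩ := hA (ε ^ 2) (by positivity)
    have hR := isSetRing_blockRing e
    have hB' := blockRing_subset_measRing hB
    refine ⟨_, h1 (simpleInd e B hB') (ind_mem_of_blockRing hB), ?_⟩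
    have hAB : A \ B ∈ measRing e := (isSetRing_measRing e).sdiff_mem hA hB'
    have heq : simpleInd e A hA - simpleInd e B hB' = simpleInd e (A \ B) hAB := by
      apply Subtype.ext
      change ind A - ind B = ind (A \ B)
      funext x
      by_cases h1 : x ∈ B
      · simp [ind, h1, hBA h1]
      · by_cases h2 : x ∈ A <;> simp [ind, h1, h2]
    rw [dist_eq_norm, ← UniformSpace.Completion.coe_sub, heq, UniformSpace.Completion.norm_coe]
    have hn : ‖simpleInd e (A \ B) hAB‖ ^ 2 = lam e (A \ B) := by
      have h := inner_simpleInd hAB hAB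
      rw [inter_self, inner_self_eq_norm_sq_to_K] at h
      exact Complex.ofReal_injective (by rw [← h]; push_cast; rfl)
    have hle := (lam_bounds hR.empty_mem (hR.sdiff_mem hC hB) (empty_subset _)
      (sdiff_subset_sdiff_left hAC)).2
    exact lt_of_pow_lt_pow_left₀ 2 hε.le (by rw [hn]; exact hle.trans_lt hl)
  refine Submodule.eq_top_iff'.2 fun f => ?_
  refine UniformSpace.Completion.induction_on f hVc fun f => ?_
  obtain ⟨c, hc⟩ := mem_simpleSpan.1 f.fn_mem
  have : f = ∑ A ∈ c.support, c A • simpleInd e A A.2 := by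
    apply Subtype.ext
    change f.fn = (simpleSpan (fun A : measRing e => (A : Set E))).subtype
      (∑ A ∈ c.support, c A • simpleInd e A A.2 : Simple e)
    erw [map_sum]
    rw [← hc, comb, Finsupp.linearCombination_apply, Finsupp.sum]
    rfl
  rw [this]
  change UniformSpace.Completion.toComplL (𝕜 := ℂ) (∑ A ∈ c.support, _) ∈ _
  rw [map_sum]
  refine Submodule.sum_mem _ fun A _ => ?_
  rw [map_smul]
  exact Submodule.smul_mem _ _ (h2 A A.2)

/-- A property of vectors that is stable under linear combinations and limits holds for all vectors
if it holds for the indicator functions of blocks. -/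
lemma L2.block_induction {P : L2 e → Prop} (hblock : ∀ Q : Block e, P (blockVec Q))
    (hzero : P 0) (hadd : ∀ f g, P f → P g → P (f + g)) (hsmul : ∀ (z : ℂ) f, P f → P (z • f))
    (hlim : ∀ (u : ℕ → L2 e) f, (∀ n, P (u n)) → Tendsto u atTop (𝓝 f) → P f) (f : L2 e) :
    P f := by
  have hf : f ∈ (Submodule.span ℂ (range (blockVec (e := e)))).topologicalClosure := by
    rw [dense_span_blockVec]; trivial
  obtain ⟨u, hu, hlu⟩ := mem_closure_iff_seq_limit.1 hf
  refine hlim u f (fun n => ?_) hlu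
  refine Submodule.span_induction (p := fun f _ => P f) ?_ hzero (fun f g _ _ => hadd f g)
    (fun z f _ => hsmul z f) (hu n)
  rintro _ ⟨Q, rfl⟩
  exact hblock Q

/-! ### Shifts -/

lemma norm_shift (h : E) (f : L2 e) : ‖shift e h f‖ = ‖f‖ := by
  refine UniformSpace.Completion.induction_on f
    (isClosed_eq ((shift e h).continuous.norm) continuous_norm) fun f => ?_
  rw [shift, ContinuousLinearMap.completion_apply_coe, UniformSpace.Completion.norm_coe,
    UniformSpace.Completion.norm_coe]
  exact (Simple.shift e h).norm_map f

lemma shift_add (h k : E) (f : L2 e) : shift e (h + k) f = shift e h (shift e k f) := by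
  refine UniformSpace.Completion.induction_on f
    (isClosed_eq (shift e _).continuous ((shift e h).continuous.comp (shift e k).continuous))
    fun f => ?_
  simp only [shift, ContinuousLinearMap.completion_apply_coe]
  congr 1
  apply Subtype.ext
  funext x
  change f.fn (x - (h + k)) = f.fn (x - h - k)
  rw [sub_sub]

lemma shift_zero (f : L2 e) : shift e 0 f = f := by
  have h0 : shift e 0 (shift e 0 f) = shift e 0 f := by rw [← shift_add, add_zero]
  have h1 : ‖shift e 0 f - f‖ = 0 := by rw [← norm_shift 0, map_sub, h0, sub_self, norm_zero]
  exact sub_eq_zero.1 (norm_eq_zero.1 h1)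

lemma inner_shift_shift (h : E) (f g : L2 e) : ⟪shift e h f, shift e h g⟫_ℂ = ⟪f, g⟫_ℂ :=
  (LinearMap.norm_map_iff_inner_map_map (shift e h)).1 (norm_shift h) f g

lemma inner_shift_right (h : E) (f g : L2 e) : ⟪g, shift e h f⟫_ℂ = ⟪shift e (-h) g, f⟫_ℂ := by
  rw [← inner_shift_shift h (shift e (-h) g), ← shift_add, add_neg_cancel, shift_zero]

lemma norm_inner_shift_le (h : E) (f g : L2 e) : ‖⟪g, shift e h f⟫_ℂ‖ ≤ ‖g‖ * ‖f‖ := by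
  simpa only [norm_shift] using norm_inner_le_norm (𝕜 := ℂ) g (shift e h f)

/-- For the indicator functions of two blocks the inner product is the measure of an intersection,
which is a limit of continuous functions of the shift; the general case follows by density. -/
lemma measurable_inner_shift [MeasurableSpace E] [BorelSpace E] (f g : L2 e) :
    Measurable fun h => ⟪g, shift e h f⟫_ℂ := by
  refine L2.block_induction (P := fun g => ∀ f, Measurable fun h => ⟪g, shift e h f⟫_ℂ)
    (fun Q f => ?_) (fun f => by simp) (fun g g' hg hg' f => ?_) (fun z g hg f => ?_)
    (fun u g hu hlim f => ?_) g f
  · refine L2.block_induction (P := fun f => Measurable fun h => ⟪blockVec Q, shift e h f⟫_ℂ)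
      (fun W => ?_) (by simp) (fun g g' hg hg' => ?_) (fun z g hg => ?_)
      (fun u g hu hlim => ?_) f
    · rcases Q.toSet.eq_empty_or_nonempty with hQ | hQ
      · simp [blockVec_eq_zero_of_empty hQ]
      rcases W.toSet.eq_empty_or_nonempty with hW | hW
      · simp [blockVec_eq_zero_of_empty hW]
      simp only [shift_blockVec, inner_blockVec]
      refine Complex.measurable_ofReal.comp (measurable_of_tendsto_metrizable (f := fun n h =>
        ∏ j ∈ Finset.range n, max 0 (min (Q.b j) ((W.translate h).b j) -
          max (Q.a j) ((W.translate h).a j))) (fun n => ?_) (tendsto_pi_nhds.2 fun h => ?_))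
      · refine Continuous.measurable ?_
        simp only [Block.translate]
        fun_prop
      · refine tendsto_blockMeasure_inter hQ ?_
        obtain ⟨x, hx⟩ := hW
        exact ⟨x + h, by
          rw [Block.toSet_translate]
          change x + h - h ∈ W.toSet
          rwa [add_sub_cancel_right]⟩
    · simp only [map_add, inner_add_right]
      exact hg.add hg'
    · simpa only [map_smul, inner_smul_right] using hg.const_mul z
    · exact measurable_of_tendsto_metrizable hu (tendsto_pi_nhds.2 fun h =>
        tendsto_const_nhds.inner (((shift e h).continuous.tendsto _).comp hlim))
  · simp only [inner_add_left]
    exact (hg f).add (hg' f)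
  · simpa only [inner_smul_left] using (hg f).const_mul _
  · exact measurable_of_tendsto_metrizable (fun n => hu n f) (tendsto_pi_nhds.2 fun h =>
      hlim.inner tendsto_const_nhds)

/-! ### Averages of shifts -/

section Average

variable [MeasurableSpace E]

lemma norm_integral_inner_shift_le (ν : Measure E) [IsProbabilityMeasure ν] (f g : L2 e) :
    ‖∫ h, ⟪g, shift e h f⟫_ℂ ∂ν‖ ≤ ‖g‖ * ‖f‖ := by
  simpa using norm_integral_le_of_norm_le_const (μ := ν)
    (Eventually.of_forall fun h => norm_inner_shift_le h f g)

lemma IsShiftAverage.unique {ν : Measure E} {U V : L2 e →L[ℂ] L2 e} (hU : IsShiftAverage e ν U)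
    (hV : IsShiftAverage e ν V) : U = V :=
  ContinuousLinearMap.ext fun f => ext_inner_left ℂ fun g => by
    rw [← (hU f g).2, ← (hV f g).2]

variable [BorelSpace E]

lemma integrable_inner_shift (ν : Measure E) [IsFiniteMeasure ν] (f g : L2 e) :
    Integrable (fun h => ⟪g, shift e h f⟫_ℂ) ν :=
  Integrable.of_bound (measurable_inner_shift f g).aestronglyMeasurable (‖g‖ * ‖f‖)
    (Eventually.of_forall fun h => norm_inner_shift_le h f g)

lemma exists_isShiftAverage (e : HilbertBasis ℕ ℝ E) (ν : Measure E) [IsProbabilityMeasure ν] :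
    ∃ U, IsShiftAverage e ν U := by
  -- the form is conjugated, since it has to be conjugate linear in its first argument
  let B : L2 e →ₗ⋆[ℂ] L2 e →ₗ[ℂ] ℂ := LinearMap.mk₂'ₛₗ (starRingEnd ℂ) (RingHom.id ℂ)
    (fun f g => conj (∫ h, ⟪g, shift e h f⟫_ℂ ∂ν))
    (fun f f' g => by
      simp only [map_add, inner_add_right]
      rw [integral_add (integrable_inner_shift ν _ _) (integrable_inner_shift ν _ _), map_add])
    (fun z f g => by
      simp only [map_smul, inner_smul_right]
      rw [integral_const_mul, map_mul, smul_eq_mul])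
    (fun f g g' => by
      simp only [inner_add_left]
      rw [integral_add (integrable_inner_shift ν _ _) (integrable_inner_shift ν _ _), map_add])
    (fun z f g => by
      simp only [inner_smul_left]
      rw [integral_const_mul, map_mul, Complex.conj_conj, smul_eq_mul, RingHom.id_apply])
  let B' : L2 e →L⋆[ℂ] L2 e →L[ℂ] ℂ := B.mkContinuous₂ 1 fun f g => by
    change ‖conj (∫ h, ⟪g, shift e h f⟫_ℂ ∂ν)‖ ≤ _
    rw [RCLike.norm_conj, one_mul, mul_comm]
    exact norm_integral_inner_shift_le ν f g
  refine ⟨InnerProductSpace.continuousLinearMapOfBilin B', fun f g =>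
    ⟨integrable_inner_shift ν f g, ?_⟩⟩
  rw [← inner_conj_symm, InnerProductSpace.continuousLinearMapOfBilin_apply]
  exact (Complex.conj_conj _).symm

lemma isShiftAverage_shiftAverage (ν : Measure E) [IsProbabilityMeasure ν] :
    IsShiftAverage e ν (shiftAverage e ν) := by
  rw [shiftAverage, dif_pos (exists_isShiftAverage e ν)]
  exact (exists_isShiftAverage e ν).choose_spec

lemma norm_shiftAverage_le (ν : Measure E) [IsProbabilityMeasure ν] (f : L2 e) :
    ‖shiftAverage e ν f‖ ≤ ‖f‖ := by
  have h := norm_integral_inner_shift_le ν f (shiftAverage e ν f)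
  rw [((isShiftAverage_shiftAverage ν) f _).2, inner_self_eq_norm_sq_to_K, norm_pow, RCLike.norm_ofReal,
    abs_norm, sq] at h
  rcases (norm_nonneg (shiftAverage e ν f)).eq_or_lt with h0 | h0
  · rw [← h0]; exact norm_nonneg f
  · exact le_of_mul_le_mul_left h h0

/-- The average of the shifts over a convolution is the composition of the averages. -/
lemma shiftAverage_conv [SecondCountableTopology E] (μ ν : Measure E) [IsProbabilityMeasure μ]
    [IsProbabilityMeasure ν] :
    shiftAverage e (μ ∗ ν) = shiftAverage e μ ∘L shiftAverage e ν := by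
  refine IsShiftAverage.unique (isShiftAverage_shiftAverage _) fun f g =>
    ⟨integrable_inner_shift _ f g, ?_⟩
  rw [integral_conv (integrable_inner_shift _ f g), ContinuousLinearMap.comp_apply,
    ← ((isShiftAverage_shiftAverage μ) _ _).2]
  refine integral_congr_ae (Eventually.of_forall fun h => ?_)
  simp only
  rw [inner_shift_right, ← ((isShiftAverage_shiftAverage ν) _ _).2]
  simp_rw [shift_add, inner_shift_right h]

/-- How far an average of shifts moves a vector is controlled by a mean value. -/
lemma norm_shiftAverage_sub_sq_le (ν : Measure E) [IsProbabilityMeasure ν] (f : L2 e) :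
    ‖shiftAverage e ν f - f‖ ^ 2 ≤ 2 * (‖f‖ ^ 2 - (∫ h, ⟪f, shift e h f⟫_ℂ ∂ν).re) := by
  rw [((isShiftAverage_shiftAverage ν) f f).2, @norm_sub_sq ℂ, inner_re_symm]
  have := pow_le_pow_left₀ (norm_nonneg _) (norm_shiftAverage_le ν f) 2
  change _ ≤ 2 * (‖f‖ ^ 2 - RCLike.re ⟪f, shiftAverage e ν f⟫_ℂ)
  linarith

end Average

end ShiftAvg

namespace ShiftAvg

/-! ### Gaussian measures with independent coordinates -/

lemma integrable_abs_gaussianReal (v : ℝ≥0) : Integrable (fun x : ℝ => |x|) (gaussianReal 0 v) :=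
  ((memLp_id_gaussianReal (μ := 0) (v := v) 1).integrable le_rfl).abs

lemma integral_abs_gaussianReal_le (v : ℝ≥0) : ∫ x, |x| ∂gaussianReal 0 v ≤ √(v : ℝ) := by
  have h2 : MemLp (fun x : ℝ => x) 2 (gaussianReal 0 v) := memLp_id_gaussianReal 2
  have h3 := variance_eq_sub h2.abs
  have h4 := variance_fun_id_gaussianReal (μ := 0) (v := v)
  rw [variance_of_integral_eq_zero h2.aemeasurable (by simp)] at h4
  have h5 := variance_nonneg |fun x : ℝ => x| (gaussianReal 0 v)
  refine Real.le_sqrt_of_sq_le ?_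
  simp only [Pi.pow_apply, Pi.abs_apply, sq_abs] at h3
  rw [h4] at h3
  linarith

variable {E : Type*} [NormedAddCommGroup E] [InnerProductSpace ℝ E]

lemma _root_.HilbertBasis.secondCountableTopology (e : HilbertBasis ℕ ℝ E) :
    SecondCountableTopology E := by
  have h : TopologicalSpace.IsSeparable ((Submodule.span ℝ (range e) : Submodule ℝ E) : Set E) :=
    (countable_range e).isSeparable.span
  have h' := h.closure
  rw [← Submodule.topologicalClosure_coe, e.dense_span, Submodule.top_coe] at h'
  have := TopologicalSpace.isSeparable_univ_iff.1 h'
  exact UniformSpace.secondCountable_of_separable E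

/-- The law of a sequence of independent centered Gaussian variables with variances `v k`. -/
noncomputable def gaussianSeq (v : ℕ → ℝ≥0) : Measure (ℕ → ℝ) :=
  Measure.infinitePi fun k => gaussianReal 0 (v k)

instance (v : ℕ → ℝ≥0) : IsProbabilityMeasure (gaussianSeq v) := by
  rw [gaussianSeq]; infer_instance

lemma gaussianSeq_map_eval (v : ℕ → ℝ≥0) (k : ℕ) :
    (gaussianSeq v).map (fun ξ => ξ k) = gaussianReal 0 (v k) :=
  Measure.infinitePi_map_eval _ k

lemma integrable_abs_gaussianSeq (v : ℕ → ℝ≥0) (k : ℕ) :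
    Integrable (fun ξ => |ξ k|) (gaussianSeq v) := by
  have h := integrable_abs_gaussianReal (v k)
  rw [← gaussianSeq_map_eval] at h
  exact h.comp_measurable (measurable_pi_apply k)

lemma integral_abs_gaussianSeq_le (v : ℕ → ℝ≥0) (k : ℕ) :
    ∫ ξ, |ξ k| ∂gaussianSeq v ≤ √(v k : ℝ) := by
  refine le_trans (le_of_eq ?_) (integral_abs_gaussianReal_le (v k))
  rw [← gaussianSeq_map_eval, integral_map (measurable_pi_apply k).aemeasurable (by fun_prop)]

/-- A Gaussian sequence is absolutely summable, since its first absolute moments are. -/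
lemma ae_summable_gaussianSeq {v : ℕ → ℝ≥0} (hv : Summable fun k => √(v k : ℝ)) :
    ∀ᵐ ξ ∂gaussianSeq v, Summable fun k => |ξ k| := by
  have hint : ∀ k, ∫⁻ ξ, ENNReal.ofReal |ξ k| ∂gaussianSeq v ≤ ENNReal.ofReal √(v k : ℝ) :=
    fun k => by
      rw [← ofReal_integral_eq_lintegral_ofReal (integrable_abs_gaussianSeq v k)
        (Eventually.of_forall fun _ => abs_nonneg _)]
      exact ENNReal.ofReal_le_ofReal (integral_abs_gaussianSeq_le v k)
  have hmeas : ∀ k, Measurable fun ξ : ℕ → ℝ => ENNReal.ofReal |ξ k| := fun k => by fun_prop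
  have hfin : ∫⁻ ξ, ∑' k, ENNReal.ofReal |ξ k| ∂gaussianSeq v ≠ ⊤ := by
    rw [lintegral_tsum fun k => (hmeas k).aemeasurable]
    exact ne_top_of_le_ne_top hv.tsum_ofReal_ne_top (ENNReal.tsum_le_tsum hint)
  filter_upwards [ae_lt_top (Measurable.tsum hmeas) hfin] with ξ hξ
  simpa using ENNReal.summable_toReal hξ.ne

lemma summable_of_summable_sqrt {v : ℕ → ℝ≥0} (hv : Summable fun k => √(v k : ℝ)) :
    Summable fun k => (v k : ℝ) := by
  obtain ⟨C, hC⟩ := hv.tendsto_atTop_zero.bddAbove_range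
  refine Summable.of_nonneg_of_le (fun k => (v k).2) (fun k => ?_) (hv.mul_left C)
  calc (v k : ℝ) = √(v k : ℝ) * √(v k : ℝ) := (Real.mul_self_sqrt (v k).2).symm
    _ ≤ C * √(v k : ℝ) := mul_le_mul_of_nonneg_right (hC ⟨k, rfl⟩) (Real.sqrt_nonneg _)

lemma summable_mul_coord_sq (e : HilbertBasis ℕ ℝ E) {v : ℕ → ℝ≥0}
    (hv : Summable fun k => √(v k : ℝ)) (ξ : E) :
    Summable fun k => v k * ⟪e k, ξ⟫_ℝ ^ 2 := by
  refine Summable.of_nonneg_of_le (fun k => mul_nonneg (v k).2 (sq_nonneg _)) (fun k => ?_)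
    ((summable_of_summable_sqrt hv).mul_right (‖ξ‖ ^ 2))
  have := abs_coord_le (e := e) ξ k
  exact mul_le_mul_of_nonneg_left (sq_le_sq' (abs_le.1 this).1 (abs_le.1 this).2) (v k).2

lemma summable_sqrt_add {v w : ℕ → ℝ≥0} (hv : Summable fun k => √(v k : ℝ))
    (hw : Summable fun k => √(w k : ℝ)) : Summable fun k => √((v + w) k : ℝ) := by
  refine Summable.of_nonneg_of_le (fun k => Real.sqrt_nonneg _) (fun k => ?_) (hv.add hw)
  refine Real.sqrt_le_iff.2 ⟨by positivity, ?_⟩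
  have h1 := Real.sq_sqrt (v k).2
  have h2 := Real.sq_sqrt (w k).2
  have h3 : 0 ≤ √(v k : ℝ) * √(w k : ℝ) := by positivity
  simp only [Pi.add_apply, NNReal.coe_add]
  simp only [NNReal.val_eq_coe] at h1 h2
  nlinarith

lemma hasSum_smul_of_summable_abs [CompleteSpace E] (e : HilbertBasis ℕ ℝ E) {x : ℕ → ℝ}
    (hx : Summable fun k => |x k|) :
    HasSum (fun k => x k • e k) (∑' k, x k • e k) :=
  (Summable.of_norm (by simpa [norm_smul, e.orthonormal.1] using hx)).hasSum

lemma inner_tsum_smul [CompleteSpace E] (e : HilbertBasis ℕ ℝ E) {x : ℕ → ℝ}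
    (hx : Summable fun k => |x k|) (j : ℕ) :
    ⟪e j, ∑' k, x k • e k⟫_ℝ = x j := by
  have h := (hasSum_smul_of_summable_abs e hx).mapL (innerSL ℝ (e j))
  refine h.unique ?_
  convert! hasSum_ite_eq j (x j) using 2 with k
  have := orthonormal_iff_ite.1 e.orthonormal j k
  by_cases hk : k = j
  · subst hk; simp [e.orthonormal.1]
  · simp [this, hk, Ne.symm hk]

variable [MeasurableSpace E]

/-- The law of `∑ ξ_k e_k`, where the `ξ_k` are independent centered Gaussian variables with
variances `v k`. -/
noncomputable def diagGaussian (e : HilbertBasis ℕ ℝ E) (v : ℕ → ℝ≥0) : Measure E :=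
  (gaussianSeq v).map fun ξ => ∑' k, ξ k • e k

lemma gaussianMeasure_eq (e : HilbertBasis ℕ ℝ E) (D : E →L[ℝ] E) :
    gaussianMeasure e D = diagGaussian e fun k => (⟪D (e k), e k⟫_ℝ).toNNReal := rfl

variable [BorelSpace E] [CompleteSpace E] (e : HilbertBasis ℕ ℝ E)

lemma measurable_tsum_smul : Measurable fun ξ : ℕ → ℝ => ∑' k, ξ k • e k := by
  have := e.secondCountableTopology
  exact Measurable.tsum fun k => by fun_prop

instance (v : ℕ → ℝ≥0) : IsProbabilityMeasure (diagGaussian e v) :=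
  Measure.isProbabilityMeasure_map (measurable_tsum_smul e).aemeasurable

lemma integrable_abs_coord {v : ℕ → ℝ≥0} (hv : Summable fun k => √(v k : ℝ)) (j : ℕ) :
    Integrable (fun x => |⟪e j, x⟫_ℝ|) (diagGaussian e v) := by
  rw [diagGaussian, integrable_map_measure (by fun_prop) (measurable_tsum_smul e).aemeasurable]
  refine (integrable_abs_gaussianSeq v j).congr ?_
  filter_upwards [ae_summable_gaussianSeq hv] with ξ hξ
  simp [inner_tsum_smul e hξ]

lemma integral_abs_coord_le {v : ℕ → ℝ≥0} (hv : Summable fun k => √(v k : ℝ)) (j : ℕ) :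
    ∫ x, |⟪e j, x⟫_ℝ| ∂diagGaussian e v ≤ √(v j : ℝ) := by
  refine le_trans (le_of_eq ?_) (integral_abs_gaussianSeq_le v j)
  rw [diagGaussian, integral_map (measurable_tsum_smul e).aemeasurable (by fun_prop)]
  refine integral_congr_ae ?_
  filter_upwards [ae_summable_gaussianSeq hv] with ξ hξ
  simp [inner_tsum_smul e hξ]

/-- The characteristic function is the limit of those of the partial sums. -/
lemma charFun_diagGaussian {v : ℕ → ℝ≥0} (hv : Summable fun k => √(v k : ℝ)) {ξ : E} {q : ℝ}
    (hq : HasSum (fun k => v k * ⟪e k, ξ⟫_ℝ ^ 2) q) :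
    charFun (diagGaussian e v) ξ = Complex.exp (-((q / 2 : ℝ) : ℂ)) := by
  have := e.secondCountableTopology
  have hX : ∀ k, Measurable fun (x : ℝ) => x • e k := fun k => by fun_prop
  have hY : ∀ k, Measurable fun (ω : ℕ → ℝ) => ω k • e k := fun k => by fun_prop
  have hYs : ∀ n, Measurable fun (ω : ℕ → ℝ) => ∑ k ∈ Finset.range n, ω k • e k := fun n => by
    fun_prop
  have hpart : ∀ n, ∫ ω, Complex.exp (⟪∑ k ∈ Finset.range n, ω k • e k, ξ⟫_ℝ * Complex.I)
      ∂gaussianSeq v = Complex.exp (-((∑ k ∈ Finset.range n, v k * ⟪e k, ξ⟫_ℝ ^ 2) / 2 : ℝ)) := by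
    intro n
    have h1 := iIndepFun.charFun_map_fun_finsetSum_eq_prod (P := gaussianSeq v)
      (s := Finset.range n) (X := fun k ω => ω k • e k) (fun k _ => (hY k).aemeasurable)
      ((iIndepFun_infinitePi hX).restrict _)
    have h2 := congrFun h1 ξ
    rw [charFun_apply, integral_map (hYs n).aemeasurable (by fun_prop)] at h2
    rw [h2, Finset.prod_apply]
    have h3 : ∀ k, charFun ((gaussianSeq v).map fun ω => ω k • e k) ξ =
        Complex.exp (-(v k * ⟪e k, ξ⟫_ℝ ^ 2 / 2 : ℝ)) := by
      intro k
      have h4 := charFun_gaussianReal (μ := 0) (v := v k) ⟪e k, ξ⟫_ℝ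
      rw [← gaussianSeq_map_eval, charFun_apply, integral_map (measurable_pi_apply k).aemeasurable
        (by fun_prop)] at h4
      rw [charFun_apply, integral_map (hY k).aemeasurable (by fun_prop)]
      have h5 : ∀ ω : ℕ → ℝ, ⟪ω k • e k, ξ⟫_ℝ = ⟪ω k, ⟪e k, ξ⟫_ℝ⟫_ℝ := fun ω => by
        rw [real_inner_smul_left]
        simp [mul_comm]
      simp only [h5]
      rw [h4]
      congr 1
      push_cast
      ring
    simp only [h3]
    rw [← Complex.exp_sum]
    congr 1
    push_cast
    rw [Finset.sum_neg_distrib, Finset.sum_div]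
  have hc : Continuous fun x : E => Complex.exp (⟪x, ξ⟫_ℝ * Complex.I) := by fun_prop
  have hlim1 : Tendsto (fun n => ∫ ω, Complex.exp
      (⟪∑ k ∈ Finset.range n, ω k • e k, ξ⟫_ℝ * Complex.I) ∂gaussianSeq v) atTop
      (𝓝 (∫ ω, Complex.exp (⟪∑' k, ω k • e k, ξ⟫_ℝ * Complex.I) ∂gaussianSeq v)) := by
    refine tendsto_integral_of_dominated_convergence (fun _ => 1)
      (fun n => Measurable.aestronglyMeasurable (hc.measurable.comp (hYs n) :))
      (integrable_const _) (fun n => Eventually.of_forall fun ω => ?_) ?_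
    · rw [Complex.norm_exp_ofReal_mul_I]
    · filter_upwards [ae_summable_gaussianSeq hv] with ω hω
      have h := (hasSum_smul_of_summable_abs e hω).tendsto_sum_nat
      exact (hc.tendsto _).comp h
  have hlim2 : Tendsto (fun n => Complex.exp
      (-((∑ k ∈ Finset.range n, v k * ⟪e k, ξ⟫_ℝ ^ 2) / 2 : ℝ))) atTop
      (𝓝 (Complex.exp (-((q / 2 : ℝ) : ℂ)))) := by
    have hc : Continuous fun r : ℝ => Complex.exp (-((r / 2 : ℝ) : ℂ)) := by fun_prop
    exact (hc.tendsto q).comp hq.tendsto_sum_nat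
  rw [charFun_apply, diagGaussian, integral_map (measurable_tsum_smul e).aemeasurable
    (by fun_prop)]
  simp only [hpart] at hlim1
  exact tendsto_nhds_unique hlim1 hlim2

lemma diagGaussian_add {v w : ℕ → ℝ≥0} (hv : Summable fun k => √(v k : ℝ))
    (hw : Summable fun k => √(w k : ℝ)) :
    diagGaussian e (v + w) = diagGaussian e v ∗ diagGaussian e w := by
  have := e.secondCountableTopology
  have hvw := summable_sqrt_add hv hw
  refine Measure.ext_of_charFun (funext fun ξ => ?_)
  obtain ⟨q, h1⟩ := summable_mul_coord_sq e hv ξ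
  obtain ⟨r, h2⟩ := summable_mul_coord_sq e hw ξ
  have h3 : HasSum (fun k => ((v + w) k : ℝ) * ⟪e k, ξ⟫_ℝ ^ 2) (q + r) :=
    (h1.add h2).congr_fun fun k => by rw [Pi.add_apply, NNReal.coe_add, add_mul]
  rw [charFun_conv, charFun_diagGaussian e hv h1, charFun_diagGaussian e hw h2,
    charFun_diagGaussian e hvw h3, ← Complex.exp_add]
  congr 1
  push_cast
  ring

end ShiftAvg

namespace ShiftAvg

/-! ### Averages of shifts over Gaussian measures with small variances -/

lemma one_sub_sum_le_prod_max {ι : Type*} (s : Finset ι) {x : ι → ℝ} (hx : ∀ j, 0 ≤ x j) :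
    1 - ∑ j ∈ s, x j ≤ ∏ j ∈ s, max 0 (1 - x j) := by
  classical
  induction s using Finset.induction_on with
  | empty => simp
  | insert j s hj ih =>
    rw [Finset.sum_insert hj, Finset.prod_insert hj]
    have h0 : 0 ≤ ∏ j ∈ s, max 0 (1 - x j) := Finset.prod_nonneg fun _ _ => le_max_left _ _
    have h1 : ∏ j ∈ s, max 0 (1 - x j) ≤ 1 := Finset.prod_le_one (fun _ _ => le_max_left _ _)
      fun j _ => max_le zero_le_one (by linarith [hx j])
    have h2 := mul_le_mul_of_nonneg_right (le_max_right 0 (1 - x j)) h0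
    have h3 := mul_le_mul_of_nonneg_left h1 (hx j)
    linarith

variable {E : Type*} [NormedAddCommGroup E] [InnerProductSpace ℝ E] {e : HilbertBasis ℕ ℝ E}

/-- The product of the edge lengths of a block of nonzero measure converges to a nonzero number, so
that the lengths tend to `1`, and are bounded away from `0`. -/
lemma Block.exists_inv_edge_le (Q : Block e) (hQ : Q.vol ≠ 0) :
    ∃ C, 0 ≤ C ∧ ∀ j, (Q.b j - Q.a j)⁻¹ ≤ C := by
  have hpos : ∀ j, 0 < Q.b j - Q.a j := fun j => sub_pos.2 (Q.lt j)
  have hne : Q.toSet ≠ ∅ := fun h => hQ (by rw [Block.vol, if_neg (by simp [h])])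
  have hlim := Q.tendsto_vol hne
  have h1 := hlim.div ((tendsto_add_atTop_iff_nat 1).2 hlim) hQ
  have h2 : Tendsto (fun j => (Q.b j - Q.a j)⁻¹) atTop (𝓝 (Q.vol / Q.vol)) := by
    refine h1.congr fun n => ?_
    have := Finset.prod_pos (s := Finset.range n) fun j _ => hpos j
    simp only [Pi.div_apply]
    rw [Finset.prod_range_succ]
    field_simp
  obtain ⟨C, hC⟩ := h2.bddAbove_range
  exact ⟨C, (inv_pos.2 (hpos 0)).le.trans (hC ⟨0, rfl⟩), fun j => hC ⟨j, rfl⟩⟩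

lemma edge_inter_translate (Q : Block e) (h : E) (j : ℕ) :
    max 0 (min (Q.b j) ((Q.translate h).b j) - max (Q.a j) ((Q.translate h).a j)) =
      (Q.b j - Q.a j) * max 0 (1 - |⟪e j, h⟫_ℝ| * (Q.b j - Q.a j)⁻¹) := by
  have hpos : 0 < Q.b j - Q.a j := sub_pos.2 (Q.lt j)
  rw [mul_max_of_nonneg _ _ hpos.le, mul_zero, mul_sub, mul_one, mul_left_comm,
    mul_inv_cancel₀ hpos.ne', mul_one]
  congr 1
  simp only [Block.translate]
  rcases le_total 0 ⟪e j, h⟫_ℝ with h0 | h0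
  · rw [min_eq_left (by linarith), max_eq_right (by linarith), abs_of_nonneg h0]
    ring
  · rw [min_eq_right (by linarith), max_eq_left (by linarith), abs_of_nonpos h0]
    ring

variable [MeasurableSpace E] [BorelSpace E] [CompleteSpace E]

/-- A shift by `h` decreases the `j`-th edge of the intersection of a block and its shift by
`|(e_j, h)|`, whose mean value is at most the standard deviation. -/
lemma Block.le_re_integral_inner_shift (Q : Block e) (hQ : Q.vol ≠ 0) {C : ℝ} (hC0 : 0 ≤ C)
    (hC : ∀ j, (Q.b j - Q.a j)⁻¹ ≤ C) {v : ℕ → ℝ≥0} (hv : Summable fun k => √(v k : ℝ)) :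
    Q.vol * (1 - C * ∑' k, √(v k : ℝ)) ≤
      (∫ h, ⟪blockVec Q, shift e h (blockVec Q)⟫_ℂ ∂diagGaussian e v).re := by
  have hpos : ∀ j, 0 < Q.b j - Q.a j := fun j => sub_pos.2 (Q.lt j)
  have hne : Q.toSet.Nonempty := nonempty_iff_ne_empty.2 fun h =>
    hQ (by rw [Block.vol, if_neg (by simp [h])])
  simp only [shift_blockVec, inner_blockVec]
  rw [integral_complex_ofReal, Complex.ofReal_re]
  set p : ℕ → ℝ := fun n => ∏ j ∈ Finset.range n, (Q.b j - Q.a j) with hp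
  have hp0 : ∀ n, 0 ≤ p n := fun n => Finset.prod_nonneg fun j _ => (hpos j).le
  have hplim : Tendsto p atTop (𝓝 Q.vol) := Q.tendsto_vol hne.ne_empty
  obtain ⟨M, hM⟩ := hplim.bddAbove_range
  set F : ℕ → E → ℝ := fun n h =>
    p n * ∏ j ∈ Finset.range n, max 0 (1 - |⟪e j, h⟫_ℝ| * (Q.b j - Q.a j)⁻¹) with hF
  have hx : ∀ h j, 0 ≤ |⟪e j, h⟫_ℝ| * (Q.b j - Q.a j)⁻¹ := fun h j =>
    mul_nonneg (abs_nonneg _) (inv_pos.2 (hpos j)).le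
  have hFlim : ∀ h, Tendsto (fun n => F n h) atTop
      (𝓝 (blockMeasure e (Q.toSet ∩ (Q.translate h).toSet))) := by
    intro h
    refine (tendsto_blockMeasure_inter hne (W := Q.translate h) ?_).congr fun n => ?_
    · obtain ⟨x, hx⟩ := hne
      exact ⟨x + h, by
        rw [Block.toSet_translate]
        change x + h - h ∈ Q.toSet
        rwa [add_sub_cancel_right]⟩
    · simp only [edge_inter_translate, Finset.prod_mul_distrib, hF, hp]
  have hFmeas : ∀ n, Continuous (F n) := fun n => by fun_prop
  have hFbound : ∀ n h, ‖F n h‖ ≤ M := by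
    intro n h
    have h0 : 0 ≤ ∏ j ∈ Finset.range n, max 0 (1 - |⟪e j, h⟫_ℝ| * (Q.b j - Q.a j)⁻¹) :=
      Finset.prod_nonneg fun _ _ => le_max_left _ _
    rw [Real.norm_of_nonneg (mul_nonneg (hp0 n) h0)]
    exact (mul_le_of_le_one_right (hp0 n) (Finset.prod_le_one (fun _ _ => le_max_left _ _)
      fun j _ => max_le zero_le_one (by linarith [hx h j]))).trans (hM ⟨n, rfl⟩)
  have hlim := tendsto_integral_of_dominated_convergence (μ := diagGaussian e v) (fun _ => M)
    (fun n => (hFmeas n).measurable.aestronglyMeasurable) (integrable_const M)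
    (fun n => Eventually.of_forall (hFbound n)) (Eventually.of_forall hFlim)
  refine le_of_tendsto_of_tendsto' (hplim.mul_const _) hlim fun n => ?_
  have hint : ∀ j, Integrable (fun h => |⟪e j, h⟫_ℝ| * (Q.b j - Q.a j)⁻¹) (diagGaussian e v) :=
    fun j => (integrable_abs_coord e hv j).mul_const _
  have hint' : Integrable (fun h => ∑ j ∈ Finset.range n, |⟪e j, h⟫_ℝ| * (Q.b j - Q.a j)⁻¹)
      (diagGaussian e v) := integrable_finsetSum _ fun j _ => hint j
  calc p n * (1 - C * ∑' k, √(v k : ℝ))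
      ≤ p n * (1 - ∑ j ∈ Finset.range n,
          (∫ h, |⟪e j, h⟫_ℝ| ∂diagGaussian e v) * (Q.b j - Q.a j)⁻¹) := by
        refine mul_le_mul_of_nonneg_left (sub_le_sub_left ?_ _) (hp0 n)
        refine le_trans (Finset.sum_le_sum fun j _ => mul_le_mul (integral_abs_coord_le e hv j)
          (hC j) (inv_pos.2 (hpos j)).le (Real.sqrt_nonneg _)) ?_
        rw [← Finset.sum_mul, mul_comm]
        exact mul_le_mul_of_nonneg_left (hv.sum_le_tsum _ fun _ _ => Real.sqrt_nonneg _) hC0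
    _ = ∫ h, p n * (1 - ∑ j ∈ Finset.range n, |⟪e j, h⟫_ℝ| * (Q.b j - Q.a j)⁻¹)
          ∂diagGaussian e v := by
        rw [integral_const_mul, integral_sub (integrable_const _) hint',
          integral_finsetSum _ fun j _ => hint j]
        simp [integral_mul_const]
    _ ≤ ∫ h, F n h ∂diagGaussian e v := by
        refine integral_mono (((integrable_const _).sub hint').const_mul _)
          (Integrable.of_bound (hFmeas n).measurable.aestronglyMeasurable M
            (Eventually.of_forall (hFbound n))) fun h => ?_
        exact mul_le_mul_of_nonneg_left (one_sub_sum_le_prod_max _ (hx h)) (hp0 n)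

/-- The averages over Gaussian measures converge strongly to the identity as the sum of the
standard deviations tends to `0`. -/
lemma exists_norm_shiftAverage_sub_lt (f : L2 e) : ∀ ε > 0, ∃ δ > 0, ∀ v : ℕ → ℝ≥0,
    (Summable fun k => √(v k : ℝ)) → ∑' k, √(v k : ℝ) < δ →
      ‖shiftAverage e (diagGaussian e v) f - f‖ < ε := by
  refine L2.block_induction (P := fun f => ∀ ε > 0, ∃ δ > 0, ∀ v : ℕ → ℝ≥0,
    (Summable fun k => √(v k : ℝ)) → ∑' k, √(v k : ℝ) < δ →
      ‖shiftAverage e (diagGaussian e v) f - f‖ < ε) (fun Q ε hε => ?_)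
    (fun ε hε => ⟨1, one_pos, fun v _ _ => by simpa using hε⟩)
    (fun f g hf hg ε hε => ?_) (fun z f hf ε hε => ?_) (fun u f hu hlim ε hε => ?_) f
  · by_cases hQ : Q.vol = 0
    · have : blockVec Q = 0 := by
        have h := norm_blockVec_sq Q
        rw [hQ] at h
        simpa using h
      exact ⟨1, one_pos, fun v _ _ => by simpa [this] using hε⟩
    obtain ⟨C, hC0, hC⟩ := Q.exists_inv_edge_le hQ
    have hV : 0 ≤ Q.vol := by rw [← norm_blockVec_sq]; positivity
    have hK : 0 < 2 * (Q.vol * C) + 1 := by positivity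
    refine ⟨ε ^ 2 / (2 * (Q.vol * C) + 1), by positivity, fun v hv hlt => ?_⟩
    have h1 := norm_shiftAverage_sub_sq_le (diagGaussian e v) (blockVec Q)
    have h2 := Q.le_re_integral_inner_shift hQ hC0 hC hv
    rw [norm_blockVec_sq] at h1
    rw [lt_div_iff₀ hK] at hlt
    have h3 : 0 ≤ ∑' k, √(v k : ℝ) := tsum_nonneg fun _ => Real.sqrt_nonneg _
    refine lt_of_pow_lt_pow_left₀ 2 hε.le ?_
    nlinarith
  · obtain ⟨δ₁, h₁, hf⟩ := hf (ε / 2) (half_pos hε)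
    obtain ⟨δ₂, h₂, hg⟩ := hg (ε / 2) (half_pos hε)
    refine ⟨min δ₁ δ₂, lt_min h₁ h₂, fun v hv hlt => ?_⟩
    have h3 := hf v hv (hlt.trans_le (min_le_left _ _))
    have h4 := hg v hv (hlt.trans_le (min_le_right _ _))
    rw [map_add, add_sub_add_comm]
    exact (norm_add_le _ _).trans_lt (by linarith)
  · obtain ⟨δ, h₁, hf⟩ := hf (ε / (‖z‖ + 1)) (by positivity)
    refine ⟨δ, h₁, fun v hv hlt => ?_⟩
    have h3 := hf v hv hlt
    rw [lt_div_iff₀ (by positivity)] at h3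
    rw [map_smul, ← smul_sub, norm_smul]
    linarith [norm_nonneg (shiftAverage e (diagGaussian e v) f - f)]
  · obtain ⟨n, hn⟩ := (Metric.tendsto_nhds.1 hlim (ε / 3) (by positivity)).exists
    obtain ⟨δ, h₁, hf⟩ := hu n (ε / 3) (by positivity)
    refine ⟨δ, h₁, fun v hv hlt => ?_⟩
    have h3 := hf v hv hlt
    have h4 := norm_shiftAverage_le (diagGaussian e v) (u n - f)
    rw [dist_eq_norm] at hn
    have h5 : shiftAverage e (diagGaussian e v) f - f =
        (shiftAverage e (diagGaussian e v) (u n) - u n) -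
          shiftAverage e (diagGaussian e v) (u n - f) + (u n - f) := by
      rw [map_sub]; abel
    rw [h5]
    linarith [norm_add_le ((shiftAverage e (diagGaussian e v) (u n) - u n) -
      shiftAverage e (diagGaussian e v) (u n - f)) (u n - f),
      norm_sub_le (shiftAverage e (diagGaussian e v) (u n) - u n)
        (shiftAverage e (diagGaussian e v) (u n - f))]

end ShiftAvg

namespace ShiftAvg

/-! ### Nuclear and diagonal operators -/

variable {E : Type*} [NormedAddCommGroup E] [InnerProductSpace ℝ E]

/-- By Bessel's inequality, the diagonal of a nuclear operator is absolutely summable. -/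
lemma IsNuclear.summable_abs_inner {T : E →L[ℝ] E} (hT : IsNuclear T) (e : HilbertBasis ℕ ℝ E) :
    Summable fun k => |⟪T (e k), e k⟫_ℝ| := by
  obtain ⟨x, y, hxy, hT⟩ := hT
  have hle : ∀ n k, |⟪x n, e k⟫_ℝ * ⟪y n, e k⟫_ℝ| ≤ ‖x n‖ * ‖y n‖ := fun n k => by
    rw [abs_mul]
    have h1 := abs_real_inner_le_norm (x n) (e k)
    have h2 := abs_real_inner_le_norm (y n) (e k)
    rw [e.orthonormal.1, mul_one] at h1 h2
    exact mul_le_mul h1 h2 (abs_nonneg _) (norm_nonneg _)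
  have hs : ∀ k, Summable fun n => |⟪x n, e k⟫_ℝ * ⟪y n, e k⟫_ℝ| := fun k =>
    Summable.of_nonneg_of_le (fun _ => abs_nonneg _) (fun n => hle n k) hxy
  have h1 : ∀ k, |⟪T (e k), e k⟫_ℝ| ≤ ∑' n, |⟪x n, e k⟫_ℝ * ⟪y n, e k⟫_ℝ| := by
    intro k
    have h : HasSum (fun n => ⟪x n, e k⟫_ℝ * ⟪y n, e k⟫_ℝ) ⟪T (e k), e k⟫_ℝ := by
      rw [real_inner_comm]
      refine ((hT (e k)).mapL (innerSL ℝ (e k))).congr_fun fun n => ?_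
      rw [innerSL_apply_apply, real_inner_smul_right, real_inner_comm (y n)]
    rw [← h.tsum_eq]
    have hn : Summable fun n => ‖⟪x n, e k⟫_ℝ * ⟪y n, e k⟫_ℝ‖ := by
      simpa only [Real.norm_eq_abs] using hs k
    simpa only [Real.norm_eq_abs] using norm_tsum_le_tsum_norm hn
  have h2 : ∀ n (u : Finset ℕ), ∑ k ∈ u, |⟪x n, e k⟫_ℝ * ⟪y n, e k⟫_ℝ| ≤ ‖x n‖ * ‖y n‖ := by
    intro n u
    have hB : ∀ z : E, ∑ k ∈ u, |⟪z, e k⟫_ℝ| ^ 2 ≤ ‖z‖ ^ 2 := fun z => by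
      have := e.orthonormal.sum_inner_products_le (x := z) (s := u)
      simpa only [Real.norm_eq_abs, real_inner_comm] using this
    simp only [abs_mul]
    refine (Real.sum_mul_le_sqrt_mul_sqrt u _ _).trans ?_
    exact mul_le_mul (Real.sqrt_le_iff.2 ⟨norm_nonneg _, hB _⟩)
      (Real.sqrt_le_iff.2 ⟨norm_nonneg _, hB _⟩) (Real.sqrt_nonneg _) (norm_nonneg _)
  refine summable_of_sum_le (c := ∑' n, ‖x n‖ * ‖y n‖) (fun _ => abs_nonneg _) fun u => ?_
  refine (Finset.sum_le_sum fun k _ => h1 k).trans ?_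
  rw [← Summable.tsum_finsetSum fun k _ => hs k]
  exact Summable.tsum_le_tsum (fun n => h2 n u) (summable_sum fun k _ => hs k) hxy

/-- An eigenvector of a nonnegative operator is an eigenvector of its nonnegative square root. -/
lemma sqrt_apply_eigenvector {D R : E →L[ℝ] E} (hR : R.IsPositive) (hRD : R ∘L R = D) {x : E}
    {d : ℝ} (hx : D x = d • x) (hd : 0 ≤ d) : R x = √d • x := by
  have hRR : R (R x) = d • x := by rw [← hx, ← hRD]; rfl
  rcases hd.eq_or_lt with rfl | hd
  · have h : ⟪R x, R x⟫_ℝ = 0 := by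
      have := hR.isSymmetric (R x) x
      simp only [ContinuousLinearMap.coe_coe] at this
      rw [← this, hRR, zero_smul, inner_zero_left]
    rw [inner_self_eq_zero.1 h]
    simp
  · -- `R x - √d x` is an eigenvector for the negative number `-√d`, so that it vanishes
    have h1 : R (R x - √d • x) = -(√d • (R x - √d • x)) := by
      rw [map_sub, map_smul, hRR, smul_sub, smul_smul, Real.mul_self_sqrt hd.le]
      abel
    have h2 := hR.inner_nonneg_left (R x - √d • x)
    rw [h1, inner_neg_left, real_inner_smul_left, neg_nonneg] at h2
    have h3 := Real.sqrt_pos.2 hd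
    have h4 : ⟪R x - √d • x, R x - √d • x⟫_ℝ ≤ 0 := by
      by_contra hlt
      exact absurd h2 (not_le.2 (mul_pos h3 (not_le.1 hlt)))
    exact sub_eq_zero.1 (inner_self_eq_zero.1 (h4.antisymm real_inner_self_nonneg))

lemma coordProj_apply_basis (e : HilbertBasis ℕ ℝ E) (m k : ℕ) :
    coordProj e m (e k) = if k < m then e k else 0 := by
  have h := orthonormal_iff_ite.1 e.orthonormal
  simp [coordProj, h]

lemma hasSum_inner_of_diag {e : HilbertBasis ℕ ℝ E} {B : E →L[ℝ] E} {β : ℕ → ℝ}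
    (hB : ∀ k, B (e k) = β k • e k) (ξ : E) :
    HasSum (fun k => β k * ⟪e k, ξ⟫_ℝ ^ 2) ⟪B ξ, ξ⟫_ℝ := by
  have h := ((e.hasSum_repr ξ).mapL B).mapL (innerSL ℝ ξ)
  rw [innerSL_apply_apply, real_inner_comm] at h
  refine h.congr_fun fun k => ?_
  rw [map_smul, hB, e.repr_apply_apply, innerSL_apply_apply, real_inner_smul_right,
    real_inner_smul_right, real_inner_comm]
  ring

/-! ### The averages for a diagonal operator with a nuclear square root -/

variable [MeasurableSpace E] {e : HilbertBasis ℕ ℝ E}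

lemma gaussianMeasure_of_diag {B : E →L[ℝ] E} {β : ℕ → ℝ} (hB : ∀ k, B (e k) = β k • e k) :
    gaussianMeasure e B = diagGaussian e fun k => (β k).toNNReal := by
  rw [gaussianMeasure_eq]
  congr 1
  funext k
  rw [hB, real_inner_smul_left, real_inner_self_eq_norm_sq, e.orthonormal.1, one_pow, mul_one]

variable [BorelSpace E] [CompleteSpace E]

lemma isCenteredGaussian_of_diag {B : E →L[ℝ] E} {β : ℕ → ℝ} (hB : ∀ k, B (e k) = β k • e k)
    (h0 : ∀ k, 0 ≤ β k) (hs : Summable fun k => √(β k)) :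
    IsCenteredGaussian (gaussianMeasure e B) B := by
  rw [gaussianMeasure_of_diag hB]
  refine ⟨inferInstance, fun ξ => charFun_diagGaussian e ?_ ?_⟩
  · simpa only [Real.coe_toNNReal _ (h0 _)] using hs
  · simpa only [Real.coe_toNNReal _ (h0 _)] using hasSum_inner_of_diag hB ξ

lemma isShiftAverage_of_diag {B : E →L[ℝ] E} {β : ℕ → ℝ} (hB : ∀ k, B (e k) = β k • e k) :
    IsShiftAverage e (gaussianMeasure e B) (gaussianAverage e B) := by
  rw [gaussianAverage, gaussianMeasure_of_diag hB]
  exact isShiftAverage_shiftAverage _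

lemma norm_gaussianAverage_le {B : E →L[ℝ] E} {β : ℕ → ℝ} (hB : ∀ k, B (e k) = β k • e k)
    (f : L2 e) : ‖gaussianAverage e B f‖ ≤ ‖f‖ := by
  rw [gaussianAverage, gaussianMeasure_of_diag hB]
  exact norm_shiftAverage_le _ f

lemma gaussianAverage_add {A B : E →L[ℝ] E} {α β : ℕ → ℝ} (hA : ∀ k, A (e k) = α k • e k)
    (hB : ∀ k, B (e k) = β k • e k) (hα : ∀ k, 0 ≤ α k) (hβ : ∀ k, 0 ≤ β k)
    (hαs : Summable fun k => √(α k)) (hβs : Summable fun k => √(β k)) :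
    gaussianAverage e (A + B) = gaussianAverage e A ∘L gaussianAverage e B := by
  have := e.secondCountableTopology
  have hAB : ∀ k, (A + B) (e k) = (α k + β k) • e k := fun k => by
    rw [add_apply, hA, hB, add_smul]
  have hsum : (fun k => (α k + β k).toNNReal) =
      (fun k => (α k).toNNReal) + fun k => (β k).toNNReal :=
    funext fun k => Real.toNNReal_add (hα k) (hβ k)
  rw [gaussianAverage, gaussianAverage, gaussianAverage, gaussianMeasure_of_diag hAB,
    gaussianMeasure_of_diag hA, gaussianMeasure_of_diag hB, hsum, diagGaussian_add,
    shiftAverage_conv]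
  · simpa only [Real.coe_toNNReal _ (hα _)] using hαs
  · simpa only [Real.coe_toNNReal _ (hβ _)] using hβs

lemma exists_norm_gaussianAverage_sub_lt (f : L2 e) {ε : ℝ} (hε : 0 < ε) :
    ∃ δ > 0, ∀ (B : E →L[ℝ] E) (β : ℕ → ℝ), (∀ k, B (e k) = β k • e k) → (∀ k, 0 ≤ β k) →
      (Summable fun k => √(β k)) → ∑' k, √(β k) < δ → ‖gaussianAverage e B f - f‖ < ε := by
  obtain ⟨δ, hδ, h⟩ := exists_norm_shiftAverage_sub_lt f ε hε
  refine ⟨δ, hδ, fun B β hB h0 hs hlt => ?_⟩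
  rw [gaussianAverage, gaussianMeasure_of_diag hB]
  refine h _ ?_ ?_ <;> simpa only [Real.coe_toNNReal _ (h0 _)]

end ShiftAvg

theorem mainTheorem7 {E : Type*} [NormedAddCommGroup E] [InnerProductSpace ℝ E] [CompleteSpace E]
    [MeasurableSpace E] [BorelSpace E] (e : HilbertBasis ℕ ℝ E) (D : E →L[ℝ] E)
    (hpos : D.IsPositive) (hnuc : ShiftAvg.IsNuclear D)
    (hdiag : ∀ k, ∃ d : ℝ, D (e k) = d • e k)
    (hsqrt : ∃ R : E →L[ℝ] E, R.IsPositive ∧ R ∘L R = D ∧ ShiftAvg.IsNuclear R) :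
    -- the Gaussian measures and the Pettis integrals over them exist
    (∀ t : ℝ, 0 ≤ t →
      ShiftAvg.IsCenteredGaussian (ShiftAvg.gaussianMeasure e (t • D)) (t • D) ∧
      ShiftAvg.IsShiftAverage e (ShiftAvg.gaussianMeasure e (t • D))
        (ShiftAvg.gaussianAverage e (t • D)) ∧
      ∀ m : ℕ,
        ShiftAvg.IsCenteredGaussian
          (ShiftAvg.gaussianMeasure e (t • (D ∘L ShiftAvg.coordProj e m)))
          (t • (D ∘L ShiftAvg.coordProj e m)) ∧
        ShiftAvg.IsShiftAverage e (ShiftAvg.gaussianMeasure e (t • (D ∘L ShiftAvg.coordProj e m)))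
          (ShiftAvg.gaussianAverage e (t • (D ∘L ShiftAvg.coordProj e m)))) ∧
    -- the finite dimensional averages converge, uniformly on bounded intervals of time
    (∀ T : ℝ, 0 < T → ∀ f : ShiftAvg.L2 e,
      TendstoUniformlyOn
        (fun (m : ℕ) (t : ℝ) =>
          ShiftAvg.gaussianAverage e (t • (D ∘L ShiftAvg.coordProj e m)) f)
        (fun t : ℝ => ShiftAvg.gaussianAverage e (t • D) f) atTop (Icc 0 T)) ∧
    -- the averages form a semigroup, and it is strongly continuous
    ShiftAvg.gaussianAverage e ((0 : ℝ) • D) = ContinuousLinearMap.id ℂ (ShiftAvg.L2 e) ∧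
    (∀ s t : ℝ, 0 ≤ s → 0 ≤ t → ShiftAvg.gaussianAverage e ((s + t) • D) =
      ShiftAvg.gaussianAverage e (s • D) ∘L ShiftAvg.gaussianAverage e (t • D)) ∧
    ∀ f : ShiftAvg.L2 e, ContinuousOn (fun t : ℝ => ShiftAvg.gaussianAverage e (t • D) f) (Ici 0) := by
  obtain ⟨R, hR, hRD, hRnuc⟩ := hsqrt
  choose d hd using hdiag
  have hd0 : ∀ k, 0 ≤ d k := fun k => by
    have h := hpos.inner_nonneg_left (e k)
    rwa [hd, real_inner_smul_left, real_inner_self_eq_norm_sq, e.orthonormal.1, one_pow,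
      mul_one] at h
  have hds : Summable fun k => √(d k) := by
    refine (hRnuc.summable_abs_inner e).congr fun k => ?_
    rw [ShiftAvg.sqrt_apply_eigenvector hR hRD (hd k) (hd0 k), real_inner_smul_left,
      real_inner_self_eq_norm_sq, e.orthonormal.1, one_pow, mul_one,
      abs_of_nonneg (Real.sqrt_nonneg _)]
  -- the eigenvalues of `t D`, of `t D_m` and of their difference
  have h1 : ∀ (t : ℝ) k, (t • D) (e k) = (t * d k) • e k := fun t k => by
    rw [smul_apply, hd, smul_smul]
  have h2 : ∀ (t : ℝ) (m k : ℕ), (t • (D ∘L ShiftAvg.coordProj e m)) (e k) =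
      (t * if k < m then d k else 0) • e k := fun t m k => by
    rw [smul_apply, ContinuousLinearMap.comp_apply,
      ShiftAvg.coordProj_apply_basis]
    split_ifs <;> simp [hd, smul_smul]
  have h3 : ∀ (t : ℝ) (m k : ℕ), (t • D - t • (D ∘L ShiftAvg.coordProj e m)) (e k) =
      (t * if k < m then 0 else d k) • e k := fun t m k => by
    rw [sub_apply, h1, h2, ← sub_smul, ← mul_sub]
    split_ifs <;> simp
  have hhead0 : ∀ m k, 0 ≤ if k < m then d k else 0 := fun m k => by
    split_ifs
    exacts [hd0 k, le_rfl]
  have htail0 : ∀ m k, 0 ≤ if k < m then 0 else d k := fun m k => by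
    split_ifs
    exacts [le_rfl, hd0 k]
  have hheads : ∀ m, Summable fun k => √(if k < m then d k else 0) := fun m =>
    Summable.of_nonneg_of_le (fun _ => Real.sqrt_nonneg _) (fun k => Real.sqrt_le_sqrt (by
      split_ifs
      exacts [le_rfl, hd0 k])) hds
  have htails : ∀ m, Summable fun k => √(if k < m then 0 else d k) := fun m =>
    Summable.of_nonneg_of_le (fun _ => Real.sqrt_nonneg _) (fun k => Real.sqrt_le_sqrt (by
      split_ifs
      exacts [hd0 k, le_rfl])) hds
  have hscale : ∀ {t : ℝ} {β : ℕ → ℝ}, 0 ≤ t → (Summable fun k => √(β k)) →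
      Summable fun k => √(t * β k) := fun ht hβ => by
    simpa only [Real.sqrt_mul ht] using hβ.mul_left _
  have hscale' : ∀ {t : ℝ} (β : ℕ → ℝ), 0 ≤ t → ∑' k, √(t * β k) = √t * ∑' k, √(β k) :=
    fun β ht => by simp only [Real.sqrt_mul ht, tsum_mul_left]
  have htail : Tendsto (fun m => ∑' k, √(if k < m then 0 else d k)) atTop (𝓝 0) := by
    have h := hds.hasSum.tendsto_sum_nat.const_sub (∑' k, √(d k))
    rw [sub_self] at h
    refine h.congr fun m => ?_
    have hm : HasSum (fun k => √(if k < m then d k else 0)) (∑ k ∈ Finset.range m, √(d k)) := by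
      have hsum : ∑ k ∈ Finset.range m, √(if k < m then d k else 0) =
          ∑ k ∈ Finset.range m, √(d k) :=
        Finset.sum_congr rfl fun k hk => by rw [if_pos (Finset.mem_range.1 hk)]
      rw [← hsum]
      exact hasSum_sum_of_ne_finset_zero fun k hk => by simp [Finset.mem_range.not.1 hk]
    refine ((hds.hasSum.sub hm).congr_fun fun k => ?_).tsum_eq.symm
    split_ifs <;> simp
  have hsemi : ∀ s t : ℝ, 0 ≤ s → 0 ≤ t → ShiftAvg.gaussianAverage e ((s + t) • D) =
      ShiftAvg.gaussianAverage e (s • D) ∘L ShiftAvg.gaussianAverage e (t • D) :=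
    fun s t hs ht => by
      rw [add_smul]
      exact ShiftAvg.gaussianAverage_add (h1 s) (h1 t) (fun k => mul_nonneg hs (hd0 k))
        (fun k => mul_nonneg ht (hd0 k)) (hscale hs hds) (hscale ht hds)
  refine ⟨fun t ht => ⟨?_, ?_, fun m => ⟨?_, ?_⟩⟩, fun T hT f => ?_, ?_, hsemi, fun f => ?_⟩
  · exact ShiftAvg.isCenteredGaussian_of_diag (h1 t) (fun k => mul_nonneg ht (hd0 k))
      (hscale ht hds)
  · exact ShiftAvg.isShiftAverage_of_diag (h1 t)
  · exact ShiftAvg.isCenteredGaussian_of_diag (h2 t m) (fun k => mul_nonneg ht (hhead0 m k))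
      (hscale ht (hheads m))
  · exact ShiftAvg.isShiftAverage_of_diag (h2 t m)
  · rw [Metric.tendstoUniformlyOn_iff]
    intro ε hε
    obtain ⟨δ, hδ, h⟩ := ShiftAvg.exists_norm_gaussianAverage_sub_lt f hε
    have hlim := htail.const_mul √T
    rw [mul_zero] at hlim
    filter_upwards [hlim.eventually (gt_mem_nhds hδ)] with m hm t ht
    -- `U_{tD} f - U_{tD_m} f` is the image of `U_{tD - tD_m} f - f` under a contraction
    have hadd := ShiftAvg.gaussianAverage_add (h2 t m) (h3 t m)
      (fun k => mul_nonneg ht.1 (hhead0 m k)) (fun k => mul_nonneg ht.1 (htail0 m k))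
      (hscale ht.1 (hheads m)) (hscale ht.1 (htails m))
    rw [add_sub_cancel] at hadd
    rw [hadd, dist_eq_norm, ContinuousLinearMap.comp_apply, ← map_sub]
    refine (ShiftAvg.norm_gaussianAverage_le (h2 t m) _).trans_lt (h _ _ (h3 t m)
      (fun k => mul_nonneg ht.1 (htail0 m k)) (hscale ht.1 (htails m)) ?_)
    rw [hscale' _ ht.1]
    exact (mul_le_mul_of_nonneg_right (Real.sqrt_le_sqrt ht.2)
      (tsum_nonneg fun _ => Real.sqrt_nonneg _)).trans_lt hm
  · refine ContinuousLinearMap.ext fun f => sub_eq_zero.1 (norm_le_zero_iff.1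
      (le_of_forall_pos_lt_add fun ε hε => ?_))
    obtain ⟨δ, hδ, h⟩ := ShiftAvg.exists_norm_gaussianAverage_sub_lt f hε
    rw [zero_add]
    exact h _ _ (h1 0) (fun k => by simp) (by simp) (by simpa using hδ)
  · -- for `s ≤ t` the difference of the values at `t` and `s` is the image of `U_{(t-s)D} f - f`
    -- under a contraction
    have hdiff : ∀ s t : ℝ, 0 ≤ s → s ≤ t →
        ‖ShiftAvg.gaussianAverage e (t • D) f - ShiftAvg.gaussianAverage e (s • D) f‖ ≤
          ‖ShiftAvg.gaussianAverage e ((t - s) • D) f - f‖ := fun s t hs hst => by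
      have h := hsemi s (t - s) hs (sub_nonneg.2 hst)
      rw [add_sub_cancel] at h
      rw [h, ContinuousLinearMap.comp_apply, ← map_sub]
      exact ShiftAvg.norm_gaussianAverage_le (h1 s) _
    rw [Metric.continuousOn_iff']
    intro s hs ε hε
    obtain ⟨δ, hδ, h⟩ := ShiftAvg.exists_norm_gaussianAverage_sub_lt f hε
    have hlim : Tendsto (fun t => √|t - s| * ∑' k, √(d k)) (𝓝[Ici 0] s) (𝓝 0) := by
      have hc : Continuous fun t => √|t - s| * ∑' k, √(d k) := by fun_prop
      have h0 := hc.tendsto s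
      simp only [sub_self, abs_zero, Real.sqrt_zero, zero_mul] at h0
      exact h0.mono_left nhdsWithin_le_nhds
    have hsmall : ∀ r : ℝ, 0 ≤ r → √r * ∑' k, √(d k) < δ →
        ‖ShiftAvg.gaussianAverage e (r • D) f - f‖ < ε := fun r hr hlt =>
      h _ _ (h1 r) (fun k => mul_nonneg hr (hd0 k)) (hscale hr hds) (by rwa [hscale' _ hr])
    filter_upwards [hlim.eventually (gt_mem_nhds hδ), self_mem_nhdsWithin] with t ht ht0
    rw [dist_eq_norm]
    rcases le_total s t with hst | hst
    · rw [abs_of_nonneg (sub_nonneg.2 hst)] at ht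
      exact (hdiff s t hs hst).trans_lt (hsmall _ (sub_nonneg.2 hst) ht)
    · rw [abs_sub_comm, abs_of_nonneg (sub_nonneg.2 hst)] at ht
      rw [norm_sub_rev]
      exact (hdiff t s ht0 hst).trans_lt (hsmall _ (sub_nonneg.2 hst) ht)
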